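/- Throughout, $\beta(\tau)=\sum_{n\ge -1}\beta_n\tau^n$ is a formal Laurent series with complex coefficients, subject only to $\beta_{-1}=1$, $\beta_0=0$ (in particular the $\beta_{2n}$, $n\ge1$, need not vanish), and $\beta_k^*(\tau):=\beta(\partial_\tau)\tau^k=\sum_{s=-1}^{k}\beta_s\frac{k!}{(k-s)!}\tau^{k-s}$. **The transforms.** Let $f(x)=\sum_{k\ge\kappa}f_kx^k\in\mathbb{C}[[x]]$ with $\kappa\ge0$, $f_\kappa\ne0$, and fix a determination $\rho$ of $f_\kappa^{1/(\kappa+1)}$, used throughout. All series below are formal series in rational powers of a variable (with well-ordered support), $\partial$ is differentiation and $\partial^{-1}$ is term-by-term integration from $0$, $y^q\mapsto y^{q+1}/(q+1)$, applied only to series with all exponents $>-1$. (1) Put $$f^{\Uparrow}(n,\tau):=\sum_k f_k n^{-k}\beta_k^*(\tau)=f_\kappa\frac{n^{-\kappa}\tau^{\kappa+1}}{\kappa+1}+f^{\uparrow}(n,\tau).$$ The transform $h=\mathrm{nir}(f)$ is $$h(\nu)=\frac1{2\pi i}\int_{c-i\infty}^{c+i\infty}e^{n\nu}\frac{dn}{n}\int_0^\infty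 \exp\Big(-f_\kappa\frac{n^{-\kappa}\tau^{\kappa+1}}{\kappa+1}\Big)\exp_\#\big(-f^{\uparrow}(n,\tau)\big)\,d\tau ,$$ where $\exp_\#(X)$ is expanded in powers of $X$ and, term by term, the $\tau$-integral sends $\tau^p$ to $\rho^{-(p+1)}(\kappa+1)^{\frac{p+1}{\kappa+1}-1}\,\Gamma\big(\tfrac{p+1}{\kappa+1}\big)\,n^{\frac{\kappa(p+1)}{\kappa+1}}$ and the $n$-integral sends $n^{-q}$ to $\nu^q/\Gamma(q+1)$. (2) Let $f^*(x)=\int_0^xf$, let $g^*$ be its reciprocal, $f^*\circ g^*=\mathrm{id}$, with leading term $(\kappa+1)^{1/(\kappa+1)}\rho^{-1}y^{1/(\kappa+1)}$, and put $g=\partial g^*$, $\bar g=1/g$, $\hbar=1/h$. The transform $\mathrm{mir}$ (relative to $\beta$) is $\bar g\mapsto\hbar$. **Statement.** For every such $\beta$ and all such $f,\rho$, the series $g^*$ exists and is unique, and $h=\mathrm{nir}(f)$ is a well-defined nonzero formal series. Moreover: (a) (Formula for mir.) For every $\beta$ as above and every pair $\hbar=\mathrm{mir}(\bar g)$, $$\frac1{\hbar(\nu)}=\Big[\frac1{\bar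 g(\nu)}\exp_\#\Big(-\sum_{r\ge1}\beta_r\,I^r\,(\bar g(\nu)\partial_\nu)^r\bar g(\nu)\Big)\Big]_{I=\partial_\nu^{-1}},$$ where one expands in powers of the formal variable $I$, divides by $\bar g$, moves each $I^s$ to the left of its coefficient, and replaces it by the $s$-fold integration $\partial_\nu^{-s}$ from $0$. All exponents of the coefficient of each $I^s$ are $>-1$, and the sum over $s$ is formally convergent. (b) (Expansion of mir.) There are polynomials $\mathrm{Mir}^{n_0,\dots,n_s}\in\frac1{s!}\mathbb{Z}[\beta_1,\beta_2,\dots]$, independent of $\beta$ and $\bar g$, such that, for $r:=\sum n_i\ge1$ and $\sum i\,n_i=s$, $\mathrm{Mir}^{n_0,\dots,n_s}$ is homogeneous of degree $r+1$ when $\beta_i$ has degree $i+1$, and homogeneous of order $s$ when $\beta_i$ has order $i$; and such that, with $$\mathbb{D}_{r,s}(\bar g)=\sum_{\sum n_i=r,\ \sum i\,n_i=s}\mathrm{Mir}^{n_0,\dots,n_s}\prod_{0\le i\le s}(\bar g^{(i)})^{n_i},$$ for every $\beta$ as above and every pair $\hbar=\mathrm{mir}(\bar g)$, $$\frac1\hbar=\frac1{\bar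 g}+\sum_{r\ge1,\ \frac12(r+1)\le s\le r}\partial^{-s}\,\mathbb{D}_{r,s}(\bar g),$$ where all exponents of each $\mathbb{D}_{r,s}(\bar g)$ are $>-1$ and the sum is formally convergent. The degree $r$ may here be odd or even: if $\beta_{2m}=0$ for all $m\ge1$, then $\mathbb{D}_{r,s}=0$ for all even $r$, so that only odd degrees occur; but for every $r\ge1$, odd or even, and every $\beta$ with $\beta_r\neq0$ there is a pair $\hbar=\mathrm{mir}(\bar g)$ with $\partial^{-r}\mathbb{D}_{r,r}(\bar g)\ne0$. -/

import Mathlib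

namespace MirTransform

noncomputable section

open Polynomial

/-- Formal series in complex powers `y ^ q`, `q ∈ ℚ`, with well-ordered support.  They contain the
ramified (Puiseux) series in `y ^ (1 / (κ + 1))` in which the transforms below take their values. -/
abbrev Ramified : Type := HahnSeries ℚ ℂ

/-- Term-by-term differentiation: `y ^ q ↦ q * y ^ (q - 1)`. -/
def deriv (a : Ramified) : Ramified where
  coeff q := ((q + 1 : ℚ) : ℂ) * a.coeff (q + 1)
  isPWO_support' := by
    refine (a.isPWO_support.image_of_monotone (f := fun q : ℚ => q - 1)
      (fun x y h => sub_le_sub_right h 1)).mono ?_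
    intro q hq
    exact ⟨q + 1, right_ne_zero_of_mul hq, by simp⟩

/-- Term-by-term integration from `0`: `y ^ q ↦ y ^ (q + 1) / (q + 1)`.  It is meant for series all
of whose exponents are `> -1`; see `IntegrableAtZero`. -/
def integ (a : Ramified) : Ramified where
  coeff q := a.coeff (q - 1) / ((q : ℚ) : ℂ)
  isPWO_support' := by
    refine (a.isPWO_support.image_of_monotone (f := fun q : ℚ => q + 1)
      (fun x y h => add_le_add_left h 1)).mono ?_
    intro q hq
    refine ⟨q - 1, ?_, by simp⟩
    intro h
    exact hq (by simp [h])

/-- All exponents of the series are `> -1`, so that formal integration from `0` makes sense. -/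
def IntegrableAtZero (a : Ramified) : Prop := ∀ q ∈ a.support, -1 < q

/-- The (possibly infinite) formal sum of the family `t` exists and equals `a`. -/
def HasFormalSum {ι : Type} (t : ι → Ramified) (a : Ramified) : Prop :=
  ∃ S : HahnSeries.SummableFamily ℚ ℂ ι, (⇑S = t) ∧ S.hsum = a

open Classical in
/-- The formal sum of a family, when it exists. -/
def formalSum {ι : Type} (t : ι → Ramified) : Ramified :=
  if h : ∃ a, HasFormalSum t a then h.choose else 0

/-- `exp_#`: the exponential of a power series `E` without constant term, expanded in powers
of `E`. -/
def expSharp {A : Type} [CommRing A] [Algebra ℚ A] (E : PowerSeries A) : PowerSeries A :=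
  PowerSeries.subst E (PowerSeries.exp ℚ)

/-- `β(τ) = ∑_{n ≥ -1} β_n τ ^ n` with `β_{-1} = 1` and `β_0 = 0`. -/
structure IsAdmissible (β : LaurentSeries ℂ) : Prop where
  coeff_lt : ∀ n : ℤ, n < -1 → β.coeff n = 0
  coeff_neg_one : β.coeff (-1) = 1
  coeff_zero : β.coeff 0 = 0

/-! ### The nir-transform -/

/-- `β*_k(τ) = β(∂_τ) τ ^ k = ∑_{s = -1}^{k} β_s * k! / (k - s)! * τ ^ (k - s)`; here `s = j - 1`. -/
def betaStar (β : LaurentSeries ℂ) (k : ℕ) : ℂ[X] :=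
  ∑ j ∈ Finset.range (k + 2),
    C (β.coeff ((j : ℤ) - 1) * ((k.factorial : ℂ) / ((k + 1 - j).factorial : ℂ))) * X ^ (k + 1 - j)

/-- The tangency order `κ` of `f = ∑_{k ≥ κ} f_k x ^ k`, `f_κ ≠ 0`. -/
def tangency (f : PowerSeries ℂ) : ℕ := f.order.toNat

/-- `∑_k f_k n ^ (-k) β*_k(τ) = β(∂_τ) f(τ / n)`, a power series in `N = n⁻¹` with coefficients
polynomial in `τ`. -/
def fUpUp (β : LaurentSeries ℂ) (f : PowerSeries ℂ) : PowerSeries ℂ[X] :=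
  PowerSeries.mk fun k => C (f.coeff k) * betaStar β k

/-- The same without its leading term `f_κ n ^ (-κ) τ ^ (κ + 1) / (κ + 1)`. -/
def fUp (β : LaurentSeries ℂ) (f : PowerSeries ℂ) : PowerSeries ℂ[X] :=
  fUpUp β f - PowerSeries.monomial (tangency f)
    (C (f.coeff (tangency f) / ((tangency f : ℂ) + 1)) * X ^ (tangency f + 1))

/-- The image of `n ^ (-K) τ ^ p` under the term-by-term Laplace integration in `τ`,
`∫_0^∞ exp (-f_κ n ^ (-κ) τ ^ (κ + 1) / (κ + 1)) τ ^ p dτ`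
` = f_κ ^ (-(p + 1) / (κ + 1)) (κ + 1) ^ ((p + 1) / (κ + 1) - 1) Γ ((p + 1) / (κ + 1))`
`   * n ^ (κ (p + 1) / (κ + 1))`,
followed by the term-by-term Borel integration `n ^ (-q) ↦ ν ^ q / Γ (q + 1)`.
Here `ρ` is the chosen determination of `f_κ ^ (1 / (κ + 1))`. -/
def laplaceBorel (κ : ℕ) (ρ : ℂ) (K p : ℕ) : Ramified :=
  let σ : ℚ := ((p : ℚ) + 1) / ((κ : ℚ) + 1)
  let q : ℚ := (K : ℚ) - κ * σ
  HahnSeries.single q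
    ((ρ ^ (p + 1))⁻¹ *
      (((κ : ℝ) + 1) ^ ((σ : ℝ) - 1) * Real.Gamma (σ : ℝ) / Real.Gamma ((q : ℝ) + 1) : ℝ))

/-- The terms of the double integral
`(1 / 2πi) ∫ exp (n ν) dn / n ∫_0^∞ exp (-f_κ n ^ (-κ) τ ^ (κ + 1) / (κ + 1)) exp_# (-fUp) dτ`,
indexed by the monomials `n ^ (-K) τ ^ p` of `exp_# (-fUp)`. -/
def nirTerm (β : LaurentSeries ℂ) (f : PowerSeries ℂ) (ρ : ℂ) (i : ℕ × ℕ) : Ramified :=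
  ((expSharp (-fUp β f)).coeff i.1).coeff i.2 • laplaceBorel (tangency f) ρ i.1 i.2

/-- The nir-transform `h` of `f`. -/
def nir (β : LaurentSeries ℂ) (f : PowerSeries ℂ) (ρ : ℂ) : Ramified :=
  formalSum (nirTerm β f ρ)

/-! ### The mir-transform -/

/-- `f*(x) = ∫_0^x f`. -/
def primitive (f : PowerSeries ℂ) : PowerSeries ℂ :=
  PowerSeries.mk fun n => if n = 0 then 0 else f.coeff (n - 1) / (n : ℂ)

/-- `gs = g*` is the reciprocal of `f*`, i.e. `f* ∘ g* = id`, with the determination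
`g*(y) = ((κ + 1) ^ (1 / (κ + 1)) / ρ) * y ^ (1 / (κ + 1)) + ⋯`. -/
structure IsReciprocal (f : PowerSeries ℂ) (ρ : ℂ) (gs : Ramified) : Prop where
  pos : 0 < gs.orderTop
  comp : PowerSeries.heval gs (primitive f) = HahnSeries.single 1 1
  lead : gs.coeff (1 / ((tangency f : ℚ) + 1)) =
    ((((tangency f : ℝ) + 1) ^ (1 / ((tangency f : ℝ) + 1)) : ℝ) : ℂ) / ρ

/-- `ρ` is a determination of `f_κ ^ (1 / (κ + 1))`. -/
def IsDetermination (f : PowerSeries ℂ) (ρ : ℂ) : Prop :=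
  ρ ^ (tangency f + 1) = f.coeff (tangency f)

/-- `hbar` is the mir-transform of `gbar`, relative to `β`: there is a nonzero `f` for which
`gbar = 1 / g`, `g = ∂ g*`, `f* ∘ g* = id`, and `hbar = 1 / h`, `h = nir f`. -/
def IsMir (β : LaurentSeries ℂ) (gbar hbar : Ramified) : Prop :=
  ∃ (f : PowerSeries ℂ) (ρ : ℂ) (gs : Ramified), f ≠ 0 ∧ IsDetermination f ρ ∧
    IsReciprocal f ρ gs ∧ gbar = (deriv gs)⁻¹ ∧ hbar = (nir β f ρ)⁻¹

/-- `∑_{r ≥ 1} β_r I ^ r (gbar ∂) ^ r gbar`, a power series in the formal variable `I`. -/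
def mirExponent (β : LaurentSeries ℂ) (gbar : Ramified) : PowerSeries Ramified :=
  PowerSeries.mk fun r =>
    if r = 0 then 0 else β.coeff (r : ℤ) • (fun φ => gbar * deriv φ)^[r] gbar

/-- `(1 / gbar) exp_# (-∑_{r ≥ 1} β_r I ^ r (gbar ∂) ^ r gbar)`, before `I ^ s` is moved to the left
and replaced by the `s`-fold integration. -/
def mirSymbol (β : LaurentSeries ℂ) (gbar : Ramified) : PowerSeries Ramified :=
  PowerSeries.C gbar⁻¹ * expSharp (-mirExponent β gbar)

/-- The multi-indices `(n_0, …, n_s)` with `∑ n_i = r` and `∑ i n_i = s`. -/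
def multiIndices (r s : ℕ) : Finset (Fin (s + 1) → ℕ) :=
  (Finset.piAntidiag Finset.univ r).filter fun n => ∑ i : Fin (s + 1), (i : ℕ) * n i = s

/-- A family of coefficients `Mir^{n_0, …, n_s}`, polynomials in the variables `β_1, β_2, …`. -/
abbrev Coefficients : Type := (s : ℕ) → (Fin (s + 1) → ℕ) → MvPolynomial ℕ+ ℚ

/-- The differential operator
`D_{r,s}(gbar) = ∑ Mir^{n_0, …, n_s} ∏_{0 ≤ i ≤ s} (gbar^{(i)}) ^ n_i`, where the sum is over
`∑ n_i = r`, `∑ i n_i = s`, and the coefficients are evaluated at the coefficients of `β`. -/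
def diffOp (Mir : Coefficients) (β : LaurentSeries ℂ) (r s : ℕ) (gbar : Ramified) : Ramified :=
  ∑ n ∈ multiIndices r s,
    (MvPolynomial.aeval (fun i : ℕ+ => β.coeff ((i : ℕ) : ℤ)) (Mir s n)) •
      ∏ i : Fin (s + 1), (deriv^[(i : ℕ)] gbar) ^ n i

/-- The pairs (degree, order) `(r, s)` with `r ≥ 1` and `(r + 1) / 2 ≤ s ≤ r`. -/
abbrev DegreeOrder : Type := {p : ℕ × ℕ // 1 ≤ p.1 ∧ p.1 + 1 ≤ 2 * p.2 ∧ p.2 ≤ p.1}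

end

end MirTransform

namespace MirTransform

noncomputable section

/-! Put `N = 1/n` and `x = N τ`. Then `β(∂_τ) f(τ/n) = ∑_{r ≥ -1} β_r N^r f^{(r)}(x)`. The term `r =
-1` is `n f*(x)`, the term `r = 0` is absent, and the exponential of minus the terms `r ≥ 1` is a
series `∑_s N^s z_s(x)` (`derivSymbol`). Under the Borel integral `N^s` becomes the `s`-fold
integration. For fixed `s` what remains is, after `τ = n x`, the integral of `exp(n (ν - f*(x)))
z_s(x)` over `n` and `x`. Heuristically this is the integral of `δ(ν - f*(x)) z_s(x)`, that is `g(ν)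
z_s(g*(ν))`. Hence `h = ∑_s ∂^{-s} (g · z_s ∘ g*)` (`hasFormalSum_nir`).

The formal substitute for the delta function is Lagrange inversion. The transform keeps only the
leading term of `f*` in the Gaussian-like factor and expands the rest `w` in powers, which gives
`∑_m (-1)^m / m! ∂^m (∂x₀ · (w^m H)(x₀))`, with `x₀` the reciprocal of the leading term.
`coeff_lagrange` identifies this with `g · H(g*)`. Up to truncation errors the Lagrange series `L`
satisfies `L(f* H) = y L(H)` and `∂ L(f H) = L(H')`. If `P ^ (κ + 1) = f*`, these make `L(P^j P')`
an eigenvector of `∂ y`, hence a monomial, and the `P^j P'` determine a linear map that is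
continuous for truncation.

Convergence and rearrangement are handled by one triple family, `refinedTerm`, whose fibre sums are
at once the terms of `nir` and the terms `∂^{-s} (g · z_s ∘ g*)`.

The formula for mir follows since `gbar = 1/g = f ∘ g*`, so that `gbar ∂_ν` is `∂_x` in the variable
`x = g*(ν)` and `(gbar ∂)^r gbar = f^{(r)} ∘ g*` (`coeff_mirSymbol`). For the expansion, `(gbar ∂)^r
gbar` is a universal integral differential polynomial, divisible by `gbar`, of degree `r + 1` and
order `r`. The `m`-th power of the exponent at order `s`, divided by `gbar`, therefore has degree `r
= s + m - 1`, and `1 ≤ m ≤ s` is the stated range of `(r, s)`. In the `β_i` it has weighted degree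
`s + m = r + 1`, which gives the parity statement. For `f = x^r` the component with `m = 1`, `s = r`
is `-β_r r! g`, which is not zero. -/

theorem Ramified.smul_eq_C_mul (c : ℂ) (a : Ramified) : c • a = HahnSeries.C c * a := by
  ext q; simp

instance : IsScalarTower ℂ Ramified Ramified :=
  ⟨fun c a b => by simp only [Ramified.smul_eq_C_mul, smul_eq_mul, mul_assoc]⟩

instance : SMulCommClass ℂ Ramified Ramified :=
  ⟨fun c a b => by simp only [Ramified.smul_eq_C_mul, smul_eq_mul, mul_left_comm]⟩

theorem Ramified.add_smul (c d : ℂ) (a : Ramified) : (c + d) • a = c • a + d • a :=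
  _root_.add_smul c d a

theorem Ramified.zero_smul (a : Ramified) : (0 : ℂ) • a = 0 :=
  _root_.zero_smul ℂ a

/-! ### Formal sums of families and their rearrangement -/

namespace HasFormalSum

variable {ι ι' : Type} {t : ι → Ramified} {a b : Ramified}

theorem coeff (h : HasFormalSum t a) (q : ℚ) : a.coeff q = ∑ᶠ i, (t i).coeff q := by
  obtain ⟨S, rfl, rfl⟩ := h
  exact HahnSeries.SummableFamily.coeff_hsum

theorem finite (h : HasFormalSum t a) (q : ℚ) : {i | (t i).coeff q ≠ 0}.Finite := by
  obtain ⟨S, rfl, rfl⟩ := h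
  exact S.finite_co_support q

theorem isPWO (h : HasFormalSum t a) : (⋃ i, (t i).support).IsPWO := by
  obtain ⟨S, rfl, rfl⟩ := h
  exact S.isPWO_iUnion_support

theorem mk' (hw : (⋃ i, (t i).support).IsPWO) (hf : ∀ q, {i | (t i).coeff q ≠ 0}.Finite)
    (ha : ∀ q, a.coeff q = ∑ᶠ i, (t i).coeff q) : HasFormalSum t a := by
  refine ⟨⟨t, hw, hf⟩, rfl, ?_⟩
  ext q
  rw [ha, HahnSeries.SummableFamily.coeff_hsum]
  rfl

theorem unique (h : HasFormalSum t a) (h' : HasFormalSum t b) : a = b := by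
  ext q
  rw [h.coeff, h'.coeff]

theorem formalSum_eq (h : HasFormalSum t a) : formalSum t = a := by
  have he : ∃ a, HasFormalSum t a := ⟨a, h⟩
  rw [formalSum, dif_pos he]
  exact he.choose_spec.unique h

/-- A formal sum may be computed by first summing over the fibres of a map of the index set. -/
theorem fiberwise (h : HasFormalSum t a) (π : ι → ι') {t' : ι' → Ramified}
    (ht' : ∀ i' q, (t' i').coeff q = ∑ᶠ i ∈ {i | π i = i'}, (t i).coeff q) :
    HasFormalSum t' a := by
  classical
  -- At a fixed exponent only finitely many indices matter, so each fibre sum is a finite sum over a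
  -- filter of one common finite set.
  have key : ∀ q i', (t' i').coeff q
      = ∑ i ∈ (h.finite q).toFinset with π i = i', (t i).coeff q := by
    intro q i'
    rw [ht', ← finsum_mem_coe_finset]
    refine finsum_mem_inter_support_eq _ _ _ ?_
    ext i
    simp only [Set.mem_inter_iff, Set.mem_ofPred_eq, Function.mem_support, Finset.coe_filter,
      Set.Finite.mem_toFinset]
    tauto
  have sub : ∀ q i', (t' i').coeff q ≠ 0 → ∃ i, π i = i' ∧ (t i).coeff q ≠ 0 := by
    intro q i' hne
    rw [key] at hne
    obtain ⟨i, hi, hi'⟩ := Finset.exists_ne_zero_of_sum_ne_zero hne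
    exact ⟨i, (Finset.mem_filter.1 hi).2, hi'⟩
  have hsub : ∀ q, Function.support (fun i' => (t' i').coeff q)
      ⊆ ↑((h.finite q).toFinset.image π) := by
    intro q i' hi'
    obtain ⟨i, rfl, hi⟩ := sub q i' hi'
    exact Finset.mem_coe.2 (Finset.mem_image_of_mem _ (by simpa using hi))
  refine mk' (h.isPWO.mono ?_) (fun q => (Finset.finite_toSet _).subset (hsub q)) fun q => ?_
  · refine Set.iUnion_subset fun i' q hq => ?_
    obtain ⟨i, -, hi⟩ := sub q i' hq
    exact Set.mem_iUnion.2 ⟨i, hi⟩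
  · rw [finsum_eq_sum_of_support_subset _ (hsub q), h.coeff,
      finsum_eq_sum_of_support_subset (s := (h.finite q).toFinset) _ (by simp [Function.support])]
    simp_rw [key]
    exact (Finset.sum_fiberwise_of_maps_to (fun i hi => Finset.mem_image_of_mem _ hi) _).symm

/-- Removing one term, and terms that vanish, from a formal sum. -/
theorem comp_injective (h : HasFormalSum t a) {e : ι' → ι} (he : Function.Injective e) (i₀ : ι)
    (h₀ : i₀ ∉ Set.range e) (hz : ∀ i, i ∉ Set.range e → i ≠ i₀ → t i = 0) :
    HasFormalSum (t ∘ e) (a - t i₀) := by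
  classical
  refine mk' (h.isPWO.mono ?_) (fun q => (h.finite q).preimage he.injOn) fun q => ?_
  · exact Set.iUnion_subset fun i' => Set.subset_iUnion (fun i => (t i).support) (e i')
  · have h1 : ∑ᶠ i', ((t ∘ e) i').coeff q = ∑ᶠ i ∈ Set.range e, (t i).coeff q :=
      (finsum_mem_range (f := fun i => (t i).coeff q) he).symm
    have h2 : ∑ᶠ i, (t i).coeff q = ∑ᶠ i ∈ insert i₀ (Set.range e), (t i).coeff q := by
      rw [← finsum_mem_univ]
      refine finsum_mem_inter_support_eq _ _ _ ?_
      ext i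
      simp only [Set.univ_inter, Set.mem_inter_iff, Function.mem_support, Set.mem_insert_iff]
      refine ⟨fun hi => ⟨?_, hi⟩, fun hi => hi.2⟩
      by_contra! hc
      exact hi (by simp [hz i hc.2 hc.1])
    rw [HahnSeries.coeff_sub, h.coeff, h1, h2, finsum_mem_insert' _ h₀, add_sub_cancel_left]
    exact (h.finite q).subset fun i hi => hi.2

end HasFormalSum

/-- All exponents are of the form `(j + 1) / (κ + 1) - 1` with `j ∈ ℕ`. -/
def OnLattice (κ : ℕ) (a : Ramified) : Prop :=
  ∀ q, a.coeff q ≠ 0 → ∃ j : ℕ, q = ((j : ℚ) + 1) / ((κ : ℚ) + 1) - 1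

theorem isPWO_lattice (κ : ℕ) :
    {q : ℚ | ∃ j : ℕ, q = ((j : ℚ) + 1) / ((κ : ℚ) + 1) - 1}.IsPWO := by
  refine ((Set.isPWO_of_wellQuasiOrderedLE (Set.univ : Set ℕ)).image_of_monotone
    (f := fun j : ℕ => ((j : ℚ) + 1) / ((κ : ℚ) + 1) - 1) (fun x y h => ?_)).mono ?_
  · have : (x : ℚ) ≤ y := by exact_mod_cast h
    have : (0 : ℚ) < (κ : ℚ) + 1 := by positivity
    simp only
    gcongr
  · rintro q ⟨j, rfl⟩
    exact ⟨j, trivial, rfl⟩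

/-- The union of the supports lies in one well-ordered lattice, so only finiteness at each exponent
is left to check. -/
theorem exists_hasFormalSum_of_onLattice {ι : Type} {t : ι → Ramified} (κ : ℕ)
    (ht : ∀ i, OnLattice κ (t i)) (hf : ∀ q, {i | (t i).coeff q ≠ 0}.Finite) :
    ∃ a, HasFormalSum t a := by
  refine ⟨_, ⟨⟨t, (isPWO_lattice κ).mono ?_, hf⟩, rfl, rfl⟩⟩
  exact Set.iUnion_subset fun i q hq => ht i q hq

theorem OnLattice.gt {κ : ℕ} {a : Ramified} (h : OnLattice κ a) {q : ℚ} (hq : a.coeff q ≠ 0) :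
    1 / ((κ : ℚ) + 1) - 1 ≤ q := by
  obtain ⟨j, rfl⟩ := h q hq
  have : (0 : ℚ) < (κ : ℚ) + 1 := by positivity
  gcongr
  simp

/-- The lowest lattice point is `1 / (κ + 1) - 1`, strictly above `-1`. -/
theorem OnLattice.integrableAtZero {κ : ℕ} {a : Ramified} (h : OnLattice κ a) :
    IntegrableAtZero a := by
  intro q hq
  have := h.gt hq
  have : (0 : ℚ) < 1 / ((κ : ℚ) + 1) := by positivity
  linarith

/-! ### Differentiation and integration -/

theorem coeff_deriv (a : Ramified) (q : ℚ) :
    (deriv a).coeff q = ((q + 1 : ℚ) : ℂ) * a.coeff (q + 1) := rfl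

theorem coeff_integ (a : Ramified) (q : ℚ) :
    (integ a).coeff q = a.coeff (q - 1) / ((q : ℚ) : ℂ) := rfl

/-- `deriv` as a linear map. -/
def derivₗ : Ramified →ₗ[ℂ] Ramified where
  toFun := deriv
  map_add' a b := by ext q; simp [coeff_deriv, mul_add]
  map_smul' c a := by ext q; simp [coeff_deriv]; ring

/-- `integ` as a linear map. -/
def integₗ : Ramified →ₗ[ℂ] Ramified where
  toFun := integ
  map_add' a b := by ext q; simp [coeff_integ, add_div]
  map_smul' c a := by ext q; simp [coeff_integ]; ring

theorem derivₗ_apply (a : Ramified) : derivₗ a = deriv a := rfl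

theorem iterate_deriv_eq (m : ℕ) (a : Ramified) : deriv^[m] a = (derivₗ ^ m) a := by
  rw [Module.End.coe_pow]; rfl

theorem iterate_integ_eq (m : ℕ) (a : Ramified) : integ^[m] a = (integₗ ^ m) a := by
  rw [Module.End.coe_pow]; rfl

/-- The Euler operator `y ∂`. -/
def euler (a : Ramified) : Ramified where
  coeff q := (q : ℂ) * a.coeff q
  isPWO_support' := a.isPWO_support.mono fun _ hq => right_ne_zero_of_mul hq

theorem coeff_euler (a : Ramified) (q : ℚ) : (euler a).coeff q = (q : ℂ) * a.coeff q := rfl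

/-- Unlike `deriv`, the Euler operator does not move exponents, so the three convolutions run over
the same antidiagonal and the rule is `q = i + j` termwise. The Leibniz rule for `deriv` is deduced
from this one. -/
theorem euler_mul (a b : Ramified) : euler (a * b) = euler a * b + a * euler b := by
  ext q
  have h1 : (euler a).support ⊆ a.support := fun _ hq => right_ne_zero_of_mul hq
  have h2 : (euler b).support ⊆ b.support := fun _ hq => right_ne_zero_of_mul hq
  rw [HahnSeries.coeff_add, HahnSeries.coeff_mul_left' a.isPWO_support h1,
    HahnSeries.coeff_mul_right' b.isPWO_support h2, coeff_euler, HahnSeries.coeff_mul,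
    Finset.mul_sum, ← Finset.sum_add_distrib]
  refine Finset.sum_congr rfl fun ij hij => ?_
  rw [← (Finset.mem_antidiagonal.1 hij).2.2, coeff_euler, coeff_euler]
  push_cast
  ring

theorem deriv_eq (a : Ramified) : deriv a = HahnSeries.single (-1) 1 * euler a := by
  ext q
  have := HahnSeries.coeff_single_mul_add (r := (1 : ℂ)) (x := euler a) (a := q + 1) (b := (-1 : ℚ))
  rw [add_neg_cancel_right] at this
  rw [this, coeff_deriv, coeff_euler, one_mul]

theorem deriv_mul (a b : Ramified) : deriv (a * b) = deriv a * b + a * deriv b := by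
  simp only [deriv_eq, euler_mul]
  ring

theorem deriv_single (q : ℚ) (c : ℂ) :
    deriv (HahnSeries.single q c) = HahnSeries.single (q - 1) ((q : ℂ) * c) := by
  ext q'
  rw [coeff_deriv]
  by_cases h : q' = q - 1
  · subst h; simp
  · rw [HahnSeries.coeff_single_of_ne h, HahnSeries.coeff_single_of_ne, mul_zero]
    contrapose! h; linarith

theorem integ_single (q : ℚ) (c : ℂ) :
    integ (HahnSeries.single q c) = HahnSeries.single (q + 1) (c / ((q + 1 : ℚ) : ℂ)) := by
  ext q'
  rw [coeff_integ]
  by_cases h : q' = q + 1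
  · subst h; simp
  · rw [HahnSeries.coeff_single_of_ne h, HahnSeries.coeff_single_of_ne, zero_div]
    contrapose! h; linarith

theorem deriv_one : deriv (1 : Ramified) = 0 := by
  have := deriv_mul 1 1
  simpa using this

theorem deriv_pow_succ (a : Ramified) (n : ℕ) :
    deriv (a ^ (n + 1)) = ((n : ℂ) + 1) • (a ^ n * deriv a) := by
  induction n with
  | zero => simp
  | succ n ih =>
    rw [pow_succ, deriv_mul, ih, smul_mul_assoc]
    push_cast
    rw [Ramified.add_smul ((n : ℂ) + 1) 1, one_smul, pow_succ, mul_right_comm]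

theorem OnLattice.integ {κ : ℕ} {a : Ramified} (h : OnLattice κ a) :
    OnLattice κ (MirTransform.integ a) := by
  intro q hq
  obtain ⟨j, hj⟩ := h (q - 1) (by rintro h0; simp [coeff_integ, h0] at hq)
  refine ⟨j + (κ + 1), ?_⟩
  have : (κ : ℚ) + 1 ≠ 0 := by positivity
  push_cast
  field_simp at hj ⊢
  linarith

theorem OnLattice.iterate_integ {κ : ℕ} {a : Ramified} (h : OnLattice κ a) (s : ℕ) :
    OnLattice κ (MirTransform.integ^[s] a) := by
  induction s with
  | zero => exact h
  | succ s ih => rw [Function.iterate_succ_apply']; exact ih.integ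

/-- Each integration raises exponents by one; this bounds the orders `s` that can contribute to a
given exponent. -/
theorem OnLattice.iterate_integ_gt {κ : ℕ} {a : Ramified} (h : OnLattice κ a) (s : ℕ) {q : ℚ}
    (hq : (MirTransform.integ^[s] a).coeff q ≠ 0) : 1 / ((κ : ℚ) + 1) - 1 + s ≤ q := by
  induction s generalizing q with
  | zero => simpa using h.gt hq
  | succ s ih =>
    rw [Function.iterate_succ_apply'] at hq
    have := ih (q := q - 1) (by rintro h0; simp [coeff_integ, h0] at hq)
    push_cast
    linarith

/-- With division by zero equal to zero, `integ` kills exactly the multiples of `y ^ (-1)`, and `-1`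
is not a lattice point. -/
theorem OnLattice.integ_eq_zero {κ : ℕ} {a : Ramified} (h : OnLattice κ a)
    (h0 : MirTransform.integ a = 0) : a = 0 := by
  ext q
  by_contra hq
  have h1 := h.integrableAtZero q hq
  have h2 : (MirTransform.integ a).coeff (q + 1) = 0 := by rw [h0]; rfl
  rw [coeff_integ, add_sub_cancel_right, div_eq_zero_iff] at h2
  rcases h2 with h2 | h2
  · exact hq h2
  · have : (q + 1 : ℚ) = 0 := by exact_mod_cast h2
    linarith

theorem OnLattice.iterate_integ_eq_zero {κ : ℕ} {a : Ramified} (h : OnLattice κ a) (s : ℕ)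
    (h0 : MirTransform.integ^[s] a = 0) : a = 0 := by
  induction s with
  | zero => exact h0
  | succ s ih =>
    rw [Function.iterate_succ_apply'] at h0
    exact ih ((h.iterate_integ s).integ_eq_zero h0)

end

/-! ### The exponential of a power series without constant term -/

noncomputable section

/-- The coefficient of `exp_# E` is a finite sum. -/
theorem coeff_expSharp {A : Type} [CommRing A] [Algebra ℚ A] {E : PowerSeries A}
    (hE : PowerSeries.constantCoeff E = 0) {s M : ℕ} (hM : s < M) :
    (expSharp E).coeff s
      = ∑ m ∈ Finset.range M, (1 / (m.factorial : ℚ)) • (E ^ m).coeff s := by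
  rw [expSharp, PowerSeries.coeff_subst' (PowerSeries.HasSubst.of_constantCoeff_zero' hE)]
  simp only [PowerSeries.coeff_exp, Algebra.algebraMap_self, RingHom.id_apply]
  refine finsum_eq_sum_of_support_subset _ fun m hm => ?_
  rw [Finset.coe_range, Set.mem_Iio]
  by_contra! h
  refine hm ?_
  simp only
  rw [PowerSeries.coeff_of_lt_order, smul_zero]
  refine lt_of_lt_of_le ?_ (PowerSeries.le_order_pow_of_constantCoeff_eq_zero m hE)
  exact_mod_cast lt_of_lt_of_le hM h

theorem coeff_pow_eq_zero {A : Type} [CommRing A] {E : PowerSeries A}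
    (hE : PowerSeries.constantCoeff E = 0) {s m : ℕ} (h : s < m) : (E ^ m).coeff s = 0 :=
  PowerSeries.coeff_of_lt_order _ (lt_of_lt_of_le (by exact_mod_cast h)
    (PowerSeries.le_order_pow_of_constantCoeff_eq_zero m hE))

theorem expSharp_add {A : Type} [CommRing A] [Algebra ℚ A] {E F : PowerSeries A}
    (hE : PowerSeries.constantCoeff E = 0) (hF : PowerSeries.constantCoeff F = 0) :
    expSharp (E + F) = expSharp E * expSharp F := by
  ext s
  have hEF : PowerSeries.constantCoeff (E + F) = 0 := by rw [map_add, hE, hF, add_zero]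
  have h0 : ∀ i j, s < i + j → (E ^ i * F ^ j).coeff s = 0 := by
    intro i j hij
    refine PowerSeries.coeff_of_lt_order _ (lt_of_lt_of_le (b := ((i + j : ℕ) : ℕ∞))
      (by exact_mod_cast hij) ?_)
    refine le_trans ?_ (PowerSeries.le_order_mul _ _)
    push_cast
    exact add_le_add (PowerSeries.le_order_pow_of_constantCoeff_eq_zero i hE)
      (PowerSeries.le_order_pow_of_constantCoeff_eq_zero j hF)
  have hl : (expSharp (E + F)).coeff s = ∑ m ∈ Finset.range (s + 1),
      ∑ p ∈ Finset.HasAntidiagonal.antidiagonal m,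
        (1 / (p.1.factorial : ℚ) * (1 / (p.2.factorial : ℚ))) • (E ^ p.1 * F ^ p.2).coeff s := by
    rw [coeff_expSharp hEF (Nat.lt_succ_self s)]
    refine Finset.sum_congr rfl fun m _ => ?_
    rw [(Commute.all E F).add_pow', map_sum, Finset.smul_sum]
    refine Finset.sum_congr rfl fun p hp => ?_
    rw [Finset.HasAntidiagonal.mem_antidiagonal] at hp
    rw [map_nsmul, ← Nat.cast_smul_eq_nsmul ℚ, smul_smul, ← hp]
    congr 1
    have h1 : ((p.1 + p.2).choose p.1 : ℚ) * p.1.factorial * p.2.factorial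
        = (p.1 + p.2).factorial := by
      rw [Nat.choose_symm_add]
      exact_mod_cast Nat.add_choose_mul_factorial_mul_factorial p.1 p.2
    have h2 : ((p.1 + p.2).factorial : ℚ) ≠ 0 := by positivity
    field_simp
    exact h1
  have hr : (expSharp E * expSharp F).coeff s
      = ∑ i ∈ Finset.range (s + 1), ∑ j ∈ Finset.range (s + 1),
        (1 / (i.factorial : ℚ) * (1 / (j.factorial : ℚ))) • (E ^ i * F ^ j).coeff s := by
    rw [PowerSeries.coeff_mul]
    simp only [PowerSeries.coeff_mul, Finset.smul_sum]
    rw [Finset.sum_congr rfl fun i _ => Finset.sum_comm, Finset.sum_comm]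
    refine Finset.sum_congr rfl fun p hp => ?_
    have := Finset.HasAntidiagonal.mem_antidiagonal.1 hp
    rw [coeff_expSharp hE (M := s + 1) (by omega), coeff_expSharp hF (M := s + 1) (by omega),
      Finset.sum_mul_sum]
    refine Finset.sum_congr rfl fun i _ => Finset.sum_congr rfl fun j _ => ?_
    rw [smul_mul_smul_comm]
  rw [hl, hr, ← Finset.sum_product', Finset.sum_sigma']
  -- The left side sums over the triangle `i + j ≤ s`, the right side over a square; the remaining
  -- pairs vanish by `h0`.
  refine Finset.sum_of_injOn (fun x => x.2) ?_ ?_ ?_ ?_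
  · rintro ⟨a, p⟩ ha ⟨b, q⟩ hb hab
    simp only [Finset.coe_sigma, Set.mem_sigma_iff, Finset.mem_coe,
      Finset.HasAntidiagonal.mem_antidiagonal] at ha hb hab
    obtain rfl := hab
    rw [← ha.2, ← hb.2]
  · rintro ⟨a, p⟩ ha
    simp only [Finset.coe_sigma, Set.mem_sigma_iff, Finset.mem_coe, Finset.mem_range,
      Finset.HasAntidiagonal.mem_antidiagonal] at ha
    simp only [Finset.coe_product, Set.mem_prod, Finset.mem_coe, Finset.mem_range]
    omega
  · rintro p hp hp'
    rw [h0 p.1 p.2, smul_zero]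
    by_contra! hc
    exact hp' ⟨⟨p.1 + p.2, p⟩, by simpa using Nat.lt_succ_of_le hc, rfl⟩
  · rintro ⟨a, p⟩ ha
    rfl

theorem expSharp_map {A B : Type} [CommRing A] [Algebra ℚ A] [CommRing B] [Algebra ℚ B]
    (φ : A →+* B) {E : PowerSeries A} (hE : PowerSeries.constantCoeff E = 0) :
    expSharp (PowerSeries.map φ E) = PowerSeries.map φ (expSharp E) := by
  ext s
  have hE' : PowerSeries.constantCoeff (PowerSeries.map φ E) = 0 := by
    rw [← PowerSeries.coeff_zero_eq_constantCoeff_apply, PowerSeries.coeff_map,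
      PowerSeries.coeff_zero_eq_constantCoeff_apply, hE, map_zero]
  rw [coeff_expSharp hE' (Nat.lt_succ_self s), PowerSeries.coeff_map,
    coeff_expSharp hE (Nat.lt_succ_self s), map_sum]
  refine Finset.sum_congr rfl fun m _ => ?_
  rw [← map_pow, PowerSeries.coeff_map]
  exact (map_rat_smul φ _ _).symm

theorem expSharp_coeff_zero {A : Type} [CommRing A] [Algebra ℚ A] {E : PowerSeries A}
    (hE : PowerSeries.constantCoeff E = 0) : (expSharp E).coeff 0 = 1 := by
  rw [coeff_expSharp hE Nat.zero_lt_one]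
  simp

end

noncomputable section

theorem exists_ne_zero_of_finsum_ne_zero' {ι : Type} {t : ι → ℂ} (h : ∑ᶠ i, t i ≠ 0) :
    ∃ i, t i ≠ 0 := by
  by_contra! hc
  exact h (finsum_eq_zero_of_forall_eq_zero hc)

/-! ### Lower bounds on the exponents -/

/-- All exponents of `a` are at least `v`. -/
def SupportGE (v : ℚ) (a : Ramified) : Prop := ∀ q, a.coeff q ≠ 0 → v ≤ q

theorem SupportGE.coeff_eq_zero {v q : ℚ} {a : Ramified} (h : SupportGE v a) (hq : q < v) :
    a.coeff q = 0 := by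
  by_contra hc
  exact absurd (h q hc) (not_le.2 hq)

theorem SupportGE.mono {v w : ℚ} {a : Ramified} (h : SupportGE v a) (hw : w ≤ v) :
    SupportGE w a := fun q hq => hw.trans (h q hq)

theorem SupportGE.mul {v w : ℚ} {a b : Ramified} (ha : SupportGE v a) (hb : SupportGE w b) :
    SupportGE (v + w) (a * b) := by
  intro q hq
  rw [HahnSeries.coeff_mul] at hq
  obtain ⟨ij, hij, -⟩ := Finset.exists_ne_zero_of_sum_ne_zero hq
  obtain ⟨h1, h2, h3⟩ := Finset.mem_antidiagonal.1 hij
  rw [← h3]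
  exact add_le_add (ha _ h1) (hb _ h2)

theorem SupportGE.one : SupportGE 0 1 := by
  intro q hq
  rw [HahnSeries.coeff_one] at hq
  by_contra! h
  exact hq (if_neg h.ne)

theorem SupportGE.pow {v : ℚ} {a : Ramified} (ha : SupportGE v a) (n : ℕ) :
    SupportGE (n * v) (a ^ n) := by
  induction n with
  | zero => simpa using SupportGE.one
  | succ n ih =>
    rw [pow_succ]
    convert ih.mul ha using 1
    push_cast
    ring

theorem SupportGE.single (v : ℚ) (c : ℂ) : SupportGE v (HahnSeries.single v c) := by
  intro q hq
  by_contra! h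
  exact hq (HahnSeries.coeff_single_of_ne h.ne)

theorem SupportGE.deriv {v : ℚ} {a : Ramified} (ha : SupportGE v a) :
    SupportGE (v - 1) (deriv a) := by
  intro q hq
  linarith [ha (q + 1) (right_ne_zero_of_mul hq)]

theorem SupportGE.iterate_deriv {v : ℚ} {a : Ramified} (ha : SupportGE v a) (m : ℕ) :
    SupportGE (v - m) (MirTransform.deriv^[m] a) := by
  induction m with
  | zero => simpa using ha
  | succ m ih =>
    rw [Function.iterate_succ_apply']
    convert ih.deriv using 1
    push_cast
    ring

theorem SupportGE.orderTop_pos {v : ℚ} (hv : 0 < v) {a : Ramified} (h : SupportGE v a) :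
    0 < a.orderTop := by
  rcases eq_or_ne a 0 with rfl | ha
  · simp
  · rw [HahnSeries.zero_lt_orderTop_iff ha]
    exact hv.trans_le (h _ (HahnSeries.coeff_order_eq_zero.not.2 ha))

theorem exists_supportGE {a : Ramified} (h : 0 < a.orderTop) : ∃ v > 0, SupportGE v a := by
  rcases eq_or_ne a 0 with rfl | ha
  · exact ⟨1, one_pos, fun q hq => absurd rfl hq⟩
  · exact ⟨a.order, (HahnSeries.zero_lt_orderTop_iff ha).1 h,
      fun q hq => HahnSeries.order_le_of_coeff_ne_zero hq⟩

/-! ### Evaluation of power series -/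

/-- `heval` as a linear map. -/
def hevalₗ (x : Ramified) : PowerSeries ℂ →ₗ[ℂ] Ramified where
  toFun f := PowerSeries.heval x f
  map_add' f g := map_add _ f g
  map_smul' c f := by
    rw [PowerSeries.smul_eq_C_mul, map_mul, PowerSeries.heval_C, smul_mul_assoc, one_mul]; rfl

theorem hevalₗ_apply (x : Ramified) (f : PowerSeries ℂ) :
    hevalₗ x f = PowerSeries.heval x f := rfl

theorem coeff_heval_eq {x : Ramified} (hx : 0 < x.orderTop) (f : PowerSeries ℂ) (q : ℚ) :
    (PowerSeries.heval x f).coeff q = ∑ᶠ n, f.coeff n * (x ^ n).coeff q := by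
  rw [PowerSeries.coeff_heval]
  refine finsum_congr fun n => ?_
  simp [hx]

theorem SupportGE.heval {v : ℚ} {x : Ramified} (hx : SupportGE v x) (hv : 0 < v) {k : ℕ}
    {f : PowerSeries ℂ} (hf : PowerSeries.X ^ k ∣ f) :
    SupportGE (k * v) (PowerSeries.heval x f) := by
  intro q hq
  rw [coeff_heval_eq (hx.orderTop_pos hv)] at hq
  obtain ⟨n, hn⟩ := exists_ne_zero_of_finsum_ne_zero' hq
  have h1 := hx.pow n q (right_ne_zero_of_mul hn)
  have h2 : k ≤ n := by
    by_contra! h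
    exact left_ne_zero_of_mul hn (PowerSeries.X_pow_dvd_iff.1 hf n h)
  have h3 : (k : ℚ) ≤ n := by exact_mod_cast h2
  exact (mul_le_mul_of_nonneg_right h3 hv.le).trans h1

/-- A linear functional that only depends on a truncation of the power series is determined by its
values at the powers of the variable. -/
theorem functional_eq_zero {D : PowerSeries ℂ →ₗ[ℂ] ℂ} (hX : ∀ n, D (PowerSeries.X ^ n) = 0)
    {M : ℕ} (hM : ∀ f, D (PowerSeries.X ^ M * f) = 0) : D = 0 := by
  ext f
  have hp : ∀ p : Polynomial ℂ, D (p : PowerSeries ℂ) = 0 := by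
    intro p
    induction p using Polynomial.induction_on' with
    | add p q hp hq => rw [Polynomial.coe_add, map_add, hp, hq, add_zero]
    | monomial n a =>
      rw [Polynomial.coe_monomial, PowerSeries.monomial_eq_C_mul_X_pow,
        ← PowerSeries.smul_eq_C_mul, map_smul, hX, smul_zero]
  rw [PowerSeries.eq_X_pow_mul_shift_add_trunc M f, map_add, hM, hp, add_zero]
  rfl

/-- The coefficient of `y ^ q` as a linear map. -/
def coeffₗ (q : ℚ) : Ramified →ₗ[ℂ] ℂ where
  toFun a := a.coeff q
  map_add' _ _ := rfl
  map_smul' _ _ := rfl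

/-- Every identity between evaluations is reduced to monomials: each coefficient of either side
depends on a truncation of the power series only. -/
theorem linear_ext {L₁ L₂ : PowerSeries ℂ →ₗ[ℂ] Ramified}
    (hX : ∀ n, L₁ (PowerSeries.X ^ n) = L₂ (PowerSeries.X ^ n))
    (hc : ∀ q, ∃ M, ∀ f, (L₁ (PowerSeries.X ^ M * f)).coeff q = 0 ∧
      (L₂ (PowerSeries.X ^ M * f)).coeff q = 0) (f : PowerSeries ℂ) : L₁ f = L₂ f := by
  ext q
  obtain ⟨M, hM⟩ := hc q
  have h := functional_eq_zero (D := coeffₗ q ∘ₗ (L₁ - L₂)) (fun n => by simp [hX]) (M := M)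
    (fun f => by
      change (L₁ (PowerSeries.X ^ M * f) - L₂ (PowerSeries.X ^ M * f)).coeff q = 0
      rw [HahnSeries.coeff_sub, (hM f).1, (hM f).2, sub_zero])
  have h2 : (L₁ f - L₂ f).coeff q = 0 := congrArg (fun D => D f) h
  rwa [HahnSeries.coeff_sub, sub_eq_zero] at h2

theorem heval_pow_X {x : Ramified} (hx : 0 < x.orderTop) (n : ℕ) :
    PowerSeries.heval x (PowerSeries.X ^ n) = x ^ n := by
  rw [map_pow, PowerSeries.heval_X x hx]

theorem exists_coeff_heval_eq_zero {x : Ramified} (hx : 0 < x.orderTop) (q : ℚ) :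
    ∃ M : ℕ, ∀ f, PowerSeries.X ^ M ∣ f → (PowerSeries.heval x f).coeff q = 0 := by
  obtain ⟨v, hv, hxv⟩ := exists_supportGE hx
  obtain ⟨M, hM⟩ := exists_nat_gt (q / v)
  refine ⟨M, fun f hf => (hxv.heval hv hf).coeff_eq_zero ?_⟩
  rwa [div_lt_iff₀ hv] at hM

theorem heval_orderTop_pos {x : Ramified} (hx : 0 < x.orderTop) {P : PowerSeries ℂ}
    (hP : PowerSeries.constantCoeff P = 0) : 0 < (PowerSeries.heval x P).orderTop := by
  obtain ⟨v, hv, hxv⟩ := exists_supportGE hx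
  refine (hxv.heval hv (k := 1) ?_).orderTop_pos (by simpa using hv)
  rwa [pow_one, PowerSeries.X_dvd_iff]

/-- Associativity of composition, which lets inverse power series be transported to ramified series.
Both sides are linear in `G` and continuous for truncation, and on `X ^ n` both are `P(x) ^ n`. -/
theorem heval_subst {x : Ramified} (hx : 0 < x.orderTop) {P : PowerSeries ℂ}
    (hP : PowerSeries.constantCoeff P = 0) (G : PowerSeries ℂ) :
    PowerSeries.heval x (G.subst P) = PowerSeries.heval (PowerSeries.heval x P) G := by
  have hs : PowerSeries.HasSubst P := PowerSeries.HasSubst.of_constantCoeff_zero' hP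
  have hx' := heval_orderTop_pos hx hP
  have hE : ∀ F : PowerSeries ℂ,
      (hevalₗ x ∘ₗ (PowerSeries.substAlgHom (R := ℂ) hs).toLinearMap) F
        = PowerSeries.heval x (F.subst P) := fun F => by
    simp [hevalₗ_apply, PowerSeries.coe_substAlgHom]
  rw [← hE, ← hevalₗ_apply]
  refine linear_ext (fun n => ?_) (fun q => ?_) G
  · rw [hE, hevalₗ_apply, heval_pow_X hx', PowerSeries.subst_pow hs, PowerSeries.subst_X hs,
      map_pow]
  · obtain ⟨M, hM⟩ := exists_coeff_heval_eq_zero hx q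
    obtain ⟨M', hM'⟩ := exists_coeff_heval_eq_zero hx' q
    refine ⟨M + M', fun f => ⟨?_, ?_⟩⟩
    · rw [hE]
      refine hM _ ?_
      rw [PowerSeries.subst_mul hs, PowerSeries.subst_pow hs, PowerSeries.subst_X hs, pow_add,
        mul_assoc]
      exact (pow_dvd_pow_of_dvd (PowerSeries.X_dvd_iff.2 hP) M).mul_right _
    · rw [hevalₗ_apply]
      refine hM' _ ?_
      rw [pow_add, mul_assoc]
      exact (dvd_mul_right _ _).mul_left _

/-- The chain rule. -/
theorem deriv_heval {x : Ramified} (hx : 0 < x.orderTop) (H : PowerSeries ℂ) :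
    deriv (PowerSeries.heval x H)
      = PowerSeries.heval x (PowerSeries.derivative ℂ H) * deriv x := by
  have hE : ∀ F : PowerSeries ℂ,
      (LinearMap.mulRight ℂ (deriv x) ∘ₗ hevalₗ x ∘ₗ (PowerSeries.derivative ℂ).toLinearMap) F
        = PowerSeries.heval x (PowerSeries.derivative ℂ F) * deriv x := fun F => rfl
  have hE' : ∀ F : PowerSeries ℂ, (derivₗ ∘ₗ hevalₗ x) F = deriv (PowerSeries.heval x F) :=
    fun F => rfl
  rw [← hE, ← hE']
  refine linear_ext (fun n => ?_) (fun q => ?_) H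
  · rw [hE, hE', heval_pow_X hx]
    cases n with
    | zero => rw [pow_zero, pow_zero, deriv_one, Derivation.map_one_eq_zero, map_zero, zero_mul]
    | succ n =>
      rw [deriv_pow_succ, PowerSeries.derivative_pow, PowerSeries.derivative_X, mul_one,
        map_mul, Nat.add_sub_cancel, heval_pow_X hx, map_natCast, ← smul_mul_assoc]
      congr 1
      rw [Ramified.smul_eq_C_mul, ← HahnSeries.single_zero_natCast]
      push_cast
      rfl
  · obtain ⟨v, hv, hxv⟩ := exists_supportGE hx
    obtain ⟨M, hM⟩ := exists_nat_gt ((q + 1) / v)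
    rw [div_lt_iff₀ hv] at hM
    -- One power more than `M`, because the derivative of the power series loses one.
    refine ⟨M + 1, fun f => ⟨?_, ?_⟩⟩
    · rw [hE']
      refine (hxv.heval hv (dvd_mul_right _ _)).deriv.coeff_eq_zero ?_
      push_cast
      linarith
    · rw [hE]
      refine ((hxv.heval hv (k := M) ?_).mul hxv.deriv).coeff_eq_zero ?_
      · rw [Derivation.leibniz, PowerSeries.derivative_pow, Nat.add_sub_cancel, pow_succ]
        simp only [smul_eq_mul]
        refine dvd_add ?_ ?_
        · rw [mul_assoc]; exact dvd_mul_right _ _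
        · refine Dvd.dvd.mul_left ?_ _
          rw [PowerSeries.derivative_X, mul_one]
          exact dvd_mul_left _ _
      · linarith

/-- `y ^ (1 / (κ + 1))` times a constant. -/
abbrev root (κ : ℕ) (c : ℂ) : Ramified := HahnSeries.single (1 / ((κ : ℚ) + 1)) c

theorem root_supportGE (κ : ℕ) (c : ℂ) : SupportGE (1 / ((κ : ℚ) + 1)) (root κ c) :=
  SupportGE.single _ _

theorem root_pos (κ : ℕ) : 0 < 1 / ((κ : ℚ) + 1) := by positivity

theorem root_orderTop_pos (κ : ℕ) (c : ℂ) : 0 < (root κ c).orderTop :=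
  (root_supportGE κ c).orderTop_pos (root_pos κ)

theorem root_pow (κ : ℕ) (c : ℂ) (n : ℕ) :
    root κ c ^ n = HahnSeries.single ((n : ℚ) / ((κ : ℚ) + 1)) (c ^ n) := by
  rw [root, HahnSeries.single_pow, nsmul_eq_mul, mul_one_div]

theorem coeff_heval_root (κ : ℕ) (c : ℂ) (H : PowerSeries ℂ) (j : ℕ) :
    (PowerSeries.heval (root κ c) H).coeff ((j : ℚ) / ((κ : ℚ) + 1)) = H.coeff j * c ^ j := by
  rw [coeff_heval_eq (root_orderTop_pos κ c), finsum_eq_single _ j]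
  · rw [root_pow, HahnSeries.coeff_single_same]
  · intro n hn
    rw [root_pow, HahnSeries.coeff_single_of_ne, mul_zero]
    have : (κ : ℚ) + 1 ≠ 0 := by positivity
    intro h
    field_simp at h
    exact hn (by exact_mod_cast h.symm)

theorem coeff_heval_root_ne_zero {κ : ℕ} {c : ℂ} {H : PowerSeries ℂ} {q : ℚ}
    (h : (PowerSeries.heval (root κ c) H).coeff q ≠ 0) : ∃ j : ℕ, q = (j : ℚ) / ((κ : ℚ) + 1) := by
  rw [coeff_heval_eq (root_orderTop_pos κ c)] at h
  obtain ⟨n, hn⟩ := exists_ne_zero_of_finsum_ne_zero' h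
  refine ⟨n, ?_⟩
  by_contra hq
  rw [root_pow, HahnSeries.coeff_single_of_ne hq, mul_zero] at hn
  exact hn rfl

theorem deriv_root (κ : ℕ) (c : ℂ) :
    deriv (root κ c) = HahnSeries.single (1 / ((κ : ℚ) + 1) - 1) (c / ((κ : ℂ) + 1)) := by
  rw [deriv_single]
  congr 1
  push_cast
  ring

theorem onLattice_mul_heval_root (κ : ℕ) (c d : ℂ) (H : PowerSeries ℂ) :
    OnLattice κ (HahnSeries.single (1 / ((κ : ℚ) + 1) - 1) d * PowerSeries.heval (root κ c) H) := by
  intro q hq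
  have h1 := HahnSeries.coeff_single_mul_add (r := d) (x := PowerSeries.heval (root κ c) H)
    (a := q - (1 / ((κ : ℚ) + 1) - 1)) (b := 1 / ((κ : ℚ) + 1) - 1)
  rw [sub_add_cancel] at h1
  rw [h1] at hq
  obtain ⟨j, hj⟩ := coeff_heval_root_ne_zero (right_ne_zero_of_mul hq)
  refine ⟨j, ?_⟩
  rw [add_div]
  linarith

end

/-! ### The reciprocal of the primitive -/

noncomputable section

/-- The leading coefficient `(κ + 1) ^ (1 / (κ + 1)) / ρ` of the reciprocal. -/
def leadCoeff (κ : ℕ) (ρ : ℂ) : ℂ :=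
  ((((κ : ℝ) + 1) ^ (1 / ((κ : ℝ) + 1)) : ℝ) : ℂ) / ρ

section Tangency

variable {f : PowerSeries ℂ} {ρ : ℂ}

theorem coeff_tangency_ne_zero (hf : f ≠ 0) : f.coeff (tangency f) ≠ 0 :=
  PowerSeries.coeff_order hf

theorem coeff_eq_zero_of_lt_tangency {j : ℕ} (h : j < tangency f) : f.coeff j = 0 :=
  PowerSeries.coeff_of_lt_order_toNat j h

theorem determination_ne_zero (hf : f ≠ 0) (hρ : IsDetermination f ρ) : ρ ≠ 0 := by
  rintro rfl
  apply coeff_tangency_ne_zero hf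
  rw [← hρ, zero_pow (Nat.succ_ne_zero _)]

theorem leadCoeff_ne_zero {κ : ℕ} (h : ρ ≠ 0) : leadCoeff κ ρ ≠ 0 := by
  have : (0 : ℝ) < ((κ : ℝ) + 1) ^ (1 / ((κ : ℝ) + 1)) := by positivity
  exact div_ne_zero (by exact_mod_cast this.ne') h

theorem leadCoeff_pow (κ : ℕ) (ρ : ℂ) : leadCoeff κ ρ ^ (κ + 1) = ((κ : ℂ) + 1) / ρ ^ (κ + 1) := by
  rw [leadCoeff, div_pow, ← Complex.ofReal_pow, ← Real.rpow_natCast, ← Real.rpow_mul (by positivity)]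
  congr 1
  have : (κ : ℝ) + 1 ≠ 0 := by positivity
  push_cast
  rw [one_div_mul_cancel this, Real.rpow_one]
  push_cast
  rfl

theorem coeff_primitive_succ (f : PowerSeries ℂ) (n : ℕ) :
    (primitive f).coeff (n + 1) = f.coeff n / ((n : ℂ) + 1) := by
  rw [primitive, PowerSeries.coeff_mk, if_neg (Nat.succ_ne_zero n), Nat.add_sub_cancel]
  push_cast
  rfl

theorem coeff_primitive_zero (f : PowerSeries ℂ) : (primitive f).coeff 0 = 0 := by
  rw [primitive, PowerSeries.coeff_mk, if_pos rfl]

theorem derivative_primitive (f : PowerSeries ℂ) :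
    PowerSeries.derivative ℂ (primitive f) = f := by
  ext n
  rw [PowerSeries.coeff_derivative, coeff_primitive_succ, div_mul_cancel₀]
  exact_mod_cast Nat.succ_ne_zero n

theorem X_pow_dvd_primitive (f : PowerSeries ℂ) :
    PowerSeries.X ^ (tangency f + 1) ∣ primitive f := by
  rw [PowerSeries.X_pow_dvd_iff]
  rintro (_ | m) hm
  · exact coeff_primitive_zero f
  · rw [coeff_primitive_succ, coeff_eq_zero_of_lt_tangency (by omega), zero_div]

/-- A power series with constant coefficient `1` has roots of every order. -/
theorem exists_pow_eq (n : ℕ) (hn : n ≠ 0) {U : PowerSeries ℂ}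
    (hU : PowerSeries.constantCoeff U = 1) :
    ∃ V : PowerSeries ℂ, PowerSeries.constantCoeff V = 1 ∧ V ^ n = U := by
  have hs : PowerSeries.HasSubst (U - 1) :=
    PowerSeries.HasSubst.of_constantCoeff_zero' (by rw [map_sub, hU, map_one, sub_self])
  have hk : ∀ k : ℕ, PowerSeries.binomialSeries ℂ (1 / n : ℚ) ^ k
      = PowerSeries.binomialSeries ℂ ((k : ℚ) * (1 / n)) := by
    intro k
    induction k with
    | zero => simp
    | succ k ih =>
      rw [pow_succ, ih, ← PowerSeries.binomialSeries_add]
      push_cast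
      ring_nf
  -- The root is `(1 + X) ^ (1 / n)` at `X = U - 1`; powers of the binomial series add their
  -- exponents.
  have hpow : PowerSeries.subst (U - 1) (PowerSeries.binomialSeries ℂ (1 / n : ℚ)) ^ n = U := by
    have h1 : (n : ℚ) * (1 / n) = ((1 : ℕ) : ℚ) := by
      push_cast
      exact mul_one_div_cancel (by exact_mod_cast hn)
    rw [← PowerSeries.subst_pow hs, hk, h1, PowerSeries.binomialSeries_nat, pow_one,
      ← PowerSeries.coe_substAlgHom hs, map_add, map_one, PowerSeries.substAlgHom_X,
      add_sub_cancel]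
  refine ⟨_, ?_, hpow⟩
  have h0 : PowerSeries.constantCoeff (U - 1) = 0 := by rw [map_sub, hU, map_one, sub_self]
  have h1 := PowerSeries.constantCoeff_subst_eq_zero (a := U - 1) h0
    (PowerSeries.binomialSeries ℂ (1 / n : ℚ) - 1) (by simp)
  rw [PowerSeries.subst_sub hs, ← PowerSeries.coe_substAlgHom hs, map_one] at h1
  rw [← PowerSeries.coe_substAlgHom hs]
  have h2 := sub_eq_zero.1 ((map_sub PowerSeries.constantCoeff _ _).symm.trans h1)
  rw [h2, map_one]

/-- `P` is the root of order `κ + 1` of `f*` and `G` its compositional inverse. -/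
structure IsUniformizer (f : PowerSeries ℂ) (ρ : ℂ) (P G : PowerSeries ℂ) : Prop where
  const_P : PowerSeries.constantCoeff P = 0
  coeff_P : P.coeff 1 = (leadCoeff (tangency f) ρ)⁻¹
  pow_P : P ^ (tangency f + 1) = primitive f
  const_G : PowerSeries.constantCoeff G = 0
  coeff_G : G.coeff 1 = leadCoeff (tangency f) ρ
  subst_P : P.subst G = (PowerSeries.X : PowerSeries ℂ)
  subst_G : G.subst P = (PowerSeries.X : PowerSeries ℂ)

/-- Write `f* = X ^ (κ + 1) * W`. Since `ρ ^ (κ + 1) = f_κ`, the constant term of `W` is the `(κ +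
1)`-th power of `(leadCoeff κ ρ)⁻¹`; after normalising it to `1`, a root `V` exists and `P =
(leadCoeff κ ρ)⁻¹ X V`. Its linear coefficient is a unit, hence the inverse `G`. -/
theorem exists_isUniformizer (hf : f ≠ 0) (hρ : IsDetermination f ρ) :
    ∃ P G, IsUniformizer f ρ P G := by
  set κ := tangency f with hκ
  have hc := leadCoeff_ne_zero (κ := κ) (determination_ne_zero hf hρ)
  obtain ⟨W, hW⟩ := X_pow_dvd_primitive f
  rw [← hκ] at hW
  have hpow : (leadCoeff κ ρ)⁻¹ ^ (κ + 1) = PowerSeries.constantCoeff W := by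
    have h1 := coeff_primitive_succ f κ
    rw [hW] at h1
    have h2 := PowerSeries.coeff_X_pow_mul W (κ + 1) 0
    rw [zero_add] at h2
    rw [h2, PowerSeries.coeff_zero_eq_constantCoeff_apply] at h1
    rw [h1, inv_pow, leadCoeff_pow, hρ, inv_div]
  have hU : PowerSeries.constantCoeff (PowerSeries.C (leadCoeff κ ρ ^ (κ + 1)) * W) = 1 := by
    rw [map_mul, PowerSeries.constantCoeff_C, ← hpow, ← mul_pow, mul_inv_cancel₀ hc, one_pow]
  obtain ⟨V, hV, hVW⟩ := exists_pow_eq (κ + 1) (Nat.succ_ne_zero κ) hU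
  set P : PowerSeries ℂ := PowerSeries.C (leadCoeff κ ρ)⁻¹ * (PowerSeries.X * V) with hP
  have hP0 : PowerSeries.constantCoeff P = 0 := by simp [hP]
  have hP1 : P.coeff 1 = (leadCoeff κ ρ)⁻¹ := by
    rw [hP, PowerSeries.coeff_C_mul, ← zero_add 1, PowerSeries.coeff_succ_X_mul,
      PowerSeries.coeff_zero_eq_constantCoeff_apply, hV, mul_one]
  have hu : IsUnit (P.coeff 1) := by rw [hP1]; exact (inv_ne_zero hc).isUnit
  refine ⟨P, P.substInvOfIsUnit hu, hP0, hP1, ?_, PowerSeries.constantCoeff_substInvOfIsUnit _ _,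
    ?_, PowerSeries.subst_substInvOfIsUnit_right _ hP0 hu,
    PowerSeries.subst_substInvOfIsUnit_left _ hP0 hu⟩
  · rw [hP, ← hκ, mul_pow, mul_pow, hVW, hW, ← map_pow, mul_left_comm, ← mul_assoc (PowerSeries.C _),
      ← map_mul, ← mul_pow, inv_mul_cancel₀ hc, one_pow, map_one, one_mul]
  · rw [PowerSeries.coeff_one_substInvOfIsUnit]
    refine (eq_inv_of_mul_eq_one_left (b := P.coeff 1) ?_).trans (by rw [hP1, inv_inv])
    exact hu.val_inv_mul

theorem IsUniformizer.hasSubst_P {P G : PowerSeries ℂ} (h : IsUniformizer f ρ P G) :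
    PowerSeries.HasSubst P := PowerSeries.HasSubst.of_constantCoeff_zero' h.const_P

theorem IsUniformizer.hasSubst_G {P G : PowerSeries ℂ} (h : IsUniformizer f ρ P G) :
    PowerSeries.HasSubst G := PowerSeries.HasSubst.of_constantCoeff_zero' h.const_G

theorem root_one_pow (κ : ℕ) : root κ 1 ^ (κ + 1) = HahnSeries.single 1 1 := by
  have : (κ : ℚ) + 1 ≠ 0 := by positivity
  rw [root_pow, one_pow]
  push_cast
  rw [div_self this]

/-- With `θ = y ^ (1 / (κ + 1))` one has `f*(G(θ)) = P(G(θ)) ^ (κ + 1) = θ ^ (κ + 1) = y`. -/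
theorem IsUniformizer.isReciprocal {P G : PowerSeries ℂ} (h : IsUniformizer f ρ P G) :
    IsReciprocal f ρ (PowerSeries.heval (root (tangency f) 1) G) where
  pos := heval_orderTop_pos (root_orderTop_pos _ _) h.const_G
  comp := by
    rw [← h.pow_P, map_pow, ← heval_subst (root_orderTop_pos _ _) h.const_G, h.subst_P,
      PowerSeries.heval_X _ (root_orderTop_pos _ _), root_one_pow]
  lead := by
    have := coeff_heval_root (tangency f) 1 G 1
    rw [h.coeff_G, one_pow, mul_one, Nat.cast_one] at this
    exact this

/-- The roots of order `κ + 1` of `y`. -/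
theorem eq_root_of_pow_eq {κ : ℕ} {u : Ramified} (hu : u ^ (κ + 1) = HahnSeries.single 1 1) :
    ∃ ζ : ℂ, u = root κ ζ := by
  have hθ : root κ 1 ≠ 0 := HahnSeries.single_ne_zero one_ne_zero
  have h1 : (u / root κ 1) ^ (κ + 1) = 1 := by
    rw [div_pow, hu, root_one_pow, div_self]
    exact HahnSeries.single_ne_zero one_ne_zero
  have hprim := (Complex.isPrimitiveRoot_exp (κ + 1) (Nat.succ_ne_zero κ)).map_of_injective
    (f := (HahnSeries.C : ℂ →+* Ramified)) HahnSeries.C_injective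
  obtain ⟨i, -, hi⟩ := hprim.eq_pow_of_pow_eq_one h1
  rw [← map_pow, eq_div_iff hθ] at hi
  refine ⟨Complex.exp (2 * Real.pi * Complex.I / (κ + 1 : ℕ)) ^ i, hi.symm.trans ?_⟩
  rw [HahnSeries.C_apply, root, HahnSeries.single_mul_single, zero_add, mul_one]

/-- The core of uniqueness: `P(g*)` is a `(κ + 1)`-th root of `y`, hence `ζ y ^ (1 / (κ + 1))`, and
the prescribed leading coefficient of `g* = G(P(g*))` forces `ζ = 1`. -/
theorem IsReciprocal.heval_P {P G : PowerSeries ℂ} (h : IsUniformizer f ρ P G)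
    (hf : f ≠ 0) (hρ : IsDetermination f ρ) {gs : Ramified} (hg : IsReciprocal f ρ gs) :
    PowerSeries.heval gs P = root (tangency f) 1 := by
  obtain ⟨ζ, hζ⟩ := eq_root_of_pow_eq (κ := tangency f) (u := PowerSeries.heval gs P) (by
    rw [← map_pow, h.pow_P, hg.comp])
  have h1 : gs = PowerSeries.heval (root (tangency f) ζ) G := by
    rw [← hζ, ← heval_subst hg.pos h.const_P, h.subst_G, PowerSeries.heval_X _ hg.pos]
  have h2 := coeff_heval_root (tangency f) ζ G 1
  rw [← h1, h.coeff_G, pow_one, Nat.cast_one, hg.lead] at h2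
  rw [hζ, mul_left_cancel₀ (leadCoeff_ne_zero (determination_ne_zero hf hρ))
    (h2.symm.trans (mul_one (leadCoeff (tangency f) ρ)).symm)]

theorem IsReciprocal.eq_heval {P G : PowerSeries ℂ} (h : IsUniformizer f ρ P G)
    (hf : f ≠ 0) (hρ : IsDetermination f ρ) {gs : Ramified} (hg : IsReciprocal f ρ gs) :
    gs = PowerSeries.heval (root (tangency f) 1) G := by
  rw [← hg.heval_P h hf hρ, ← heval_subst hg.pos h.const_P, h.subst_G,
    PowerSeries.heval_X _ hg.pos]

theorem existsUnique_isReciprocal (hf : f ≠ 0) (hρ : IsDetermination f ρ) :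
    ∃! gs, IsReciprocal f ρ gs := by
  obtain ⟨P, G, h⟩ := exists_isUniformizer hf hρ
  exact ⟨_, h.isReciprocal, fun gs hg => hg.eq_heval h hf hρ⟩

/-- Differentiate `f*(g*(y)) = y`. -/
theorem IsReciprocal.heval_mul_deriv {gs : Ramified} (hg : IsReciprocal f ρ gs) :
    PowerSeries.heval gs f * deriv gs = 1 := by
  have h1 := deriv_heval hg.pos (primitive f)
  rw [derivative_primitive, hg.comp, deriv_single] at h1
  rw [← h1]
  norm_num

theorem IsReciprocal.inv_deriv {gs : Ramified} (hg : IsReciprocal f ρ gs) :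
    (deriv gs)⁻¹ = PowerSeries.heval gs f :=
  (eq_inv_of_mul_eq_one_left hg.heval_mul_deriv).symm

theorem IsReciprocal.deriv_ne_zero {gs : Ramified} (hg : IsReciprocal f ρ gs) :
    deriv gs ≠ 0 := right_ne_zero_of_mul_eq_one hg.heval_mul_deriv

/-- In the variable `x = g*(y)` the derivation `gbar ∂_y` is `∂_x`. -/
theorem IsReciprocal.iterate {gs : Ramified} (hg : IsReciprocal f ρ gs) (r : ℕ) :
    (fun φ => (deriv gs)⁻¹ * deriv φ)^[r] (deriv gs)⁻¹
      = PowerSeries.heval gs ((PowerSeries.derivative ℂ)^[r] f) := by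
  induction r with
  | zero => exact hg.inv_deriv
  | succ r ih =>
    rw [Function.iterate_succ_apply', Function.iterate_succ_apply', ih, deriv_heval hg.pos,
      mul_left_comm, inv_mul_cancel₀ hg.deriv_ne_zero, mul_one]

/-- Written in the variable `y ^ (1 / (κ + 1))`, which shows that the exponents lie on the lattice.
-/
theorem IsReciprocal.deriv_mul_heval {P G : PowerSeries ℂ} (h : IsUniformizer f ρ P G)
    (hf : f ≠ 0) (hρ : IsDetermination f ρ) {gs : Ramified} (hg : IsReciprocal f ρ gs)
    (H : PowerSeries ℂ) :
    deriv gs * PowerSeries.heval gs H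
      = HahnSeries.single (1 / ((tangency f : ℚ) + 1) - 1) (1 / ((tangency f : ℂ) + 1)) *
        PowerSeries.heval (root (tangency f) 1)
          (PowerSeries.derivative ℂ G * H.subst G) := by
  rw [hg.eq_heval h hf hρ, deriv_heval (root_orderTop_pos _ _), deriv_root, map_mul,
    heval_subst (root_orderTop_pos _ _) h.const_G]
  ring

theorem IsReciprocal.onLattice (hf : f ≠ 0) (hρ : IsDetermination f ρ) {gs : Ramified}
    (hg : IsReciprocal f ρ gs) (H : PowerSeries ℂ) :
    OnLattice (tangency f) (deriv gs * PowerSeries.heval gs H) := by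
  obtain ⟨P, G, h⟩ := exists_isUniformizer hf hρ
  rw [hg.deriv_mul_heval h hf hρ]
  exact onLattice_mul_heval_root _ _ _ _

end Tangency

end

/-! ### Lagrange inversion in ramified series -/

noncomputable section

section Lagrange

variable (f : PowerSeries ℂ) (ρ : ℂ)

/-- The leading term of `f*`. -/
def leadPrim : PowerSeries ℂ :=
  PowerSeries.C (f.coeff (tangency f) / ((tangency f : ℂ) + 1)) * PowerSeries.X ^ (tangency f + 1)

/-- `f*` without its leading term. -/
def restPrim : PowerSeries ℂ := primitive f - leadPrim f

/-- `H ↦ ∂(x₀) H(x₀)` for the reciprocal `x₀` of the leading term of `f*`. -/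
def leadMap : PowerSeries ℂ →ₗ[ℂ] Ramified :=
  LinearMap.mulLeft ℂ (deriv (root (tangency f) (leadCoeff (tangency f) ρ))) ∘ₗ
    hevalₗ (root (tangency f) (leadCoeff (tangency f) ρ))

theorem leadMap_apply (H : PowerSeries ℂ) :
    leadMap f ρ H = deriv (root (tangency f) (leadCoeff (tangency f) ρ)) *
      PowerSeries.heval (root (tangency f) (leadCoeff (tangency f) ρ)) H := rfl

/-- The truncated Lagrange series `∑_{m < M} (-1)^m / m! ∂^m (∂(x₀) (w^m H)(x₀))`. -/
def lagrange (M : ℕ) : PowerSeries ℂ →ₗ[ℂ] Ramified :=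
  ∑ m ∈ Finset.range M, ((-1 : ℂ) ^ m / (m.factorial : ℂ)) •
    ((derivₗ ^ m) ∘ₗ leadMap f ρ ∘ₗ LinearMap.mulLeft ℂ (restPrim f ^ m))

theorem lagrange_apply (M : ℕ) (H : PowerSeries ℂ) :
    lagrange f ρ M H = ∑ m ∈ Finset.range M, ((-1 : ℂ) ^ m / (m.factorial : ℂ)) •
      deriv^[m] (leadMap f ρ (restPrim f ^ m * H)) := by
  simp only [lagrange, LinearMap.sum_apply, iterate_deriv_eq]
  rfl

variable {f ρ}

theorem lagrange_succ (M : ℕ) (H : PowerSeries ℂ) :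
    lagrange f ρ (M + 1) H = lagrange f ρ M H + ((-1 : ℂ) ^ M / (M.factorial : ℂ)) •
      deriv^[M] (leadMap f ρ (restPrim f ^ M * H)) := by
  rw [lagrange_apply, lagrange_apply, Finset.sum_range_succ]

theorem lagrange_zero (H : PowerSeries ℂ) : lagrange f ρ 0 H = 0 := by
  rw [lagrange_apply, Finset.sum_range_zero]

/-- One order more than the leading term: a factor `restPrim f` raises the exponent by at least `(κ
+ 2) / (κ + 1)`, more than a derivative takes away. -/
theorem X_pow_dvd_restPrim : PowerSeries.X ^ (tangency f + 2) ∣ restPrim f := by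
  rw [PowerSeries.X_pow_dvd_iff]
  intro m hm
  rw [restPrim, leadPrim, map_sub, PowerSeries.coeff_C_mul, PowerSeries.coeff_X_pow]
  rcases m with _ | m
  · rw [coeff_primitive_zero]; simp
  · rw [coeff_primitive_succ]
    by_cases h : m = tangency f
    · subst h; simp
    · rw [coeff_eq_zero_of_lt_tangency (by omega), if_neg (by omega)]; simp

theorem heval_leadPrim (hf : f ≠ 0) (hρ : IsDetermination f ρ) :
    PowerSeries.heval (root (tangency f) (leadCoeff (tangency f) ρ)) (leadPrim f)
      = HahnSeries.single 1 1 := by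
  rw [leadPrim, map_mul, PowerSeries.heval_C, heval_pow_X (root_orderTop_pos _ _), root_pow,
    smul_mul_assoc, one_mul, leadCoeff_pow, hρ, Ramified.smul_eq_C_mul, HahnSeries.C_apply,
    HahnSeries.single_mul_single, zero_add]
  have h1 : ((tangency f : ℂ) + 1) ≠ 0 := by exact_mod_cast Nat.succ_ne_zero (tangency f)
  have h2 : ((tangency f : ℚ) + 1) ≠ 0 := by positivity
  have h3 := coeff_tangency_ne_zero hf
  push_cast
  rw [div_self h2]
  congr 1
  field_simp

theorem leadMap_leadPrim_mul (hf : f ≠ 0) (hρ : IsDetermination f ρ) (H : PowerSeries ℂ) :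
    leadMap f ρ (leadPrim f * H) = HahnSeries.single 1 1 * leadMap f ρ H := by
  rw [leadMap_apply, leadMap_apply, map_mul, heval_leadPrim hf hρ]
  ring

theorem leadMap_derivative (H : PowerSeries ℂ) :
    leadMap f ρ (PowerSeries.derivative ℂ H)
      = deriv (PowerSeries.heval (root (tangency f) (leadCoeff (tangency f) ρ)) H) := by
  rw [leadMap_apply, deriv_heval (root_orderTop_pos _ _), mul_comm]

theorem leadMap_derivative_leadPrim_mul (hf : f ≠ 0) (hρ : IsDetermination f ρ)
    (H : PowerSeries ℂ) :
    leadMap f ρ (PowerSeries.derivative ℂ (leadPrim f) * H)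
      = PowerSeries.heval (root (tangency f) (leadCoeff (tangency f) ρ)) H := by
  have h1 := leadMap_derivative (f := f) (ρ := ρ) (leadPrim f)
  rw [heval_leadPrim hf hρ, deriv_single, leadMap_apply] at h1
  rw [leadMap_apply, map_mul, ← mul_assoc, h1]
  norm_num

theorem leadMap_supportGE {k : ℕ} {H : PowerSeries ℂ} (hH : PowerSeries.X ^ k ∣ H) (m : ℕ) :
    SupportGE (((k : ℚ) + 1) / ((tangency f : ℚ) + 1) - 1 - m) (deriv^[m] (leadMap f ρ H)) := by
  rw [leadMap_apply]
  convert (((root_supportGE (tangency f) (leadCoeff (tangency f) ρ)).deriv).mul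
    ((root_supportGE _ _).heval (root_pos _) hH)).iterate_deriv m using 1
  ring

/-- The net gain per step of the Lagrange series is `(κ + 2) / (κ + 1) - 1 = 1 / (κ + 1)`, so the
series converges formally. -/
theorem restPrim_supportGE {k : ℕ} {H : PowerSeries ℂ} (hH : PowerSeries.X ^ k ∣ H) (m : ℕ) :
    SupportGE (((m : ℚ) + k + 1) / ((tangency f : ℚ) + 1) - 1)
      (deriv^[m] (leadMap f ρ (restPrim f ^ m * H))) := by
  refine (leadMap_supportGE (k := (tangency f + 2) * m + k) ?_ m).mono ?_
  · rw [pow_add, pow_mul]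
    exact mul_dvd_mul (pow_dvd_pow_of_dvd X_pow_dvd_restPrim m) hH
  · have h2 : ((tangency f : ℚ) + 1) ≠ 0 := by positivity
    push_cast
    apply le_of_eq
    field_simp
    ring

theorem iterate_deriv_X_mul (m : ℕ) (a : Ramified) :
    deriv^[m + 1] (HahnSeries.single 1 1 * a)
      = HahnSeries.single 1 1 * deriv^[m + 1] a + ((m : ℂ) + 1) • deriv^[m] a := by
  have h1 : ∀ b : Ramified, deriv (HahnSeries.single 1 1 * b)
      = HahnSeries.single 1 1 * deriv b + b := by
    intro b
    rw [deriv_mul, deriv_single]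
    norm_num [add_comm]
  induction m with
  | zero => simp [h1]
  | succ m ih =>
    rw [Function.iterate_succ_apply', ih, ← derivₗ_apply, map_add, map_smul, derivₗ_apply, h1,
      derivₗ_apply, ← Function.iterate_succ_apply' deriv, ← Function.iterate_succ_apply' deriv]
    push_cast
    rw [Ramified.add_smul ((m : ℂ) + 1) 1, one_smul]
    ring

/-- Split `f*` into its leading term, which acts as multiplication by `y`, and the rest `w`, which
turns `w^m` into `w^{m+1}`. Moving `y` out of `∂^{m+1}` leaves `(m + 1) ∂^m`, which cancels the
`w`-part of the preceding summand; only the last one survives. -/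
theorem lagrange_primitive_mul (hf : f ≠ 0) (hρ : IsDetermination f ρ) (M : ℕ)
    (H : PowerSeries ℂ) :
    lagrange f ρ (M + 1) (primitive f * H)
      = HahnSeries.single 1 1 * lagrange f ρ (M + 1) H + ((-1 : ℂ) ^ M / (M.factorial : ℂ)) •
        deriv^[M] (leadMap f ρ (restPrim f ^ (M + 1) * H)) := by
  have hsplit : ∀ m, leadMap f ρ (restPrim f ^ m * (primitive f * H))
      = HahnSeries.single 1 1 * leadMap f ρ (restPrim f ^ m * H)
        + leadMap f ρ (restPrim f ^ (m + 1) * H) := by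
    intro m
    rw [← leadMap_leadPrim_mul hf hρ, ← map_add]
    congr 1
    rw [restPrim]
    ring
  induction M with
  | zero =>
    rw [lagrange_succ, lagrange_succ, lagrange_zero, lagrange_zero, hsplit]
    simp
  | succ M ih =>
    rw [lagrange_succ, ih, lagrange_succ (M + 1), hsplit, iterate_deriv_eq (M + 1), map_add,
      ← iterate_deriv_eq, ← iterate_deriv_eq, iterate_deriv_X_mul, smul_add, smul_add, mul_add,
      mul_smul_comm, smul_smul]
    have : (-1 : ℂ) ^ (M + 1) / ((M + 1).factorial : ℂ) * ((M : ℂ) + 1)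
        = -((-1 : ℂ) ^ M / (M.factorial : ℂ)) := by
      have h1 : (M.factorial : ℂ) ≠ 0 := by exact_mod_cast M.factorial_ne_zero
      have h2 : (M : ℂ) + 1 ≠ 0 := by exact_mod_cast M.succ_ne_zero
      rw [Nat.factorial_succ]
      push_cast
      field_simp
      ring
    rw [this, neg_smul]
    abel

/-- Split `f` as the derivative of the leading term plus `w'`. The first part cancels `∂x₀`, and
differentiating `(w^{m+1} H)(x₀)` gives the wanted `w^{m+1} H'` together with `(m + 1) w^m w' H`,
which telescopes against the second part. -/
theorem deriv_lagrange (hf : f ≠ 0) (hρ : IsDetermination f ρ) (M : ℕ) (H : PowerSeries ℂ) :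
    deriv (lagrange f ρ (M + 1) (f * H))
      = lagrange f ρ (M + 1) (PowerSeries.derivative ℂ H)
        + ((-1 : ℂ) ^ M / (M.factorial : ℂ)) • deriv^[M + 1] (leadMap f ρ
          (restPrim f ^ M * PowerSeries.derivative ℂ (restPrim f) * H)) := by
  have hfs : f = PowerSeries.derivative ℂ (leadPrim f) + PowerSeries.derivative ℂ (restPrim f) := by
    rw [← map_add, restPrim, add_sub_cancel, derivative_primitive]
  have hsplit : ∀ m, leadMap f ρ (restPrim f ^ m * (f * H))
      = PowerSeries.heval (root (tangency f) (leadCoeff (tangency f) ρ)) (restPrim f ^ m * H)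
        + leadMap f ρ (restPrim f ^ m * PowerSeries.derivative ℂ (restPrim f) * H) := by
    intro m
    rw [← leadMap_derivative_leadPrim_mul hf hρ, ← map_add]
    congr 1
    linear_combination (restPrim f ^ m * H) * hfs
  have hder : ∀ m : ℕ, deriv (PowerSeries.heval (root (tangency f) (leadCoeff (tangency f) ρ))
      (restPrim f ^ (m + 1) * H)) = leadMap f ρ (restPrim f ^ (m + 1) * PowerSeries.derivative ℂ H)
        + ((m : ℂ) + 1) •
          leadMap f ρ (restPrim f ^ m * PowerSeries.derivative ℂ (restPrim f) * H) := by
    intro m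
    rw [← leadMap_derivative, ← map_smul, ← map_add]
    congr 1
    rw [Derivation.leibniz, PowerSeries.derivative_pow, Nat.add_sub_cancel,
      PowerSeries.smul_eq_C_mul]
    simp only [smul_eq_mul]
    push_cast
    rw [map_add, map_natCast, map_one]
    ring
  induction M with
  | zero =>
    rw [lagrange_succ, lagrange_succ, lagrange_zero, lagrange_zero, hsplit]
    simp only [pow_zero, Nat.factorial_zero, Nat.cast_one, div_one, one_smul, zero_add, one_mul,
      Function.iterate_zero, id_eq, Function.iterate_one]
    rw [← derivₗ_apply, map_add, derivₗ_apply, ← leadMap_derivative]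
    rfl
  | succ M ih =>
    rw [lagrange_succ, ← derivₗ_apply, map_add, map_smul, derivₗ_apply, ih, derivₗ_apply,
      ← Function.iterate_succ_apply' deriv, hsplit, iterate_deriv_eq (M + 1).succ, map_add,
      ← iterate_deriv_eq, ← iterate_deriv_eq, Nat.succ_eq_add_one,
      Function.iterate_succ_apply deriv (M + 1) (PowerSeries.heval _ _), hder,
      iterate_deriv_eq (M + 1) (_ + _), map_add, map_smul, ← iterate_deriv_eq, ← iterate_deriv_eq,
      smul_add, smul_add, smul_smul, lagrange_succ (M + 1)]
    have : (-1 : ℂ) ^ (M + 1) / ((M + 1).factorial : ℂ) * ((M : ℂ) + 1)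
        = -((-1 : ℂ) ^ M / (M.factorial : ℂ)) := by
      have h1 : (M.factorial : ℂ) ≠ 0 := by exact_mod_cast M.factorial_ne_zero
      have h2 : (M : ℂ) + 1 ≠ 0 := by exact_mod_cast M.succ_ne_zero
      rw [Nat.factorial_succ]
      push_cast
      field_simp
      ring
    rw [this, neg_smul]
    abel

theorem coeff_single_one_mul (a : Ramified) (q : ℚ) :
    (HahnSeries.single 1 1 * a : Ramified).coeff (q + 1) = a.coeff q := by
  rw [HahnSeries.coeff_single_mul_add, one_mul]

theorem X_pow_dvd_derivative {n : ℕ} {F : PowerSeries ℂ} (h : PowerSeries.X ^ (n + 1) ∣ F) :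
    PowerSeries.X ^ n ∣ PowerSeries.derivative ℂ F := by
  rw [PowerSeries.X_pow_dvd_iff] at h ⊢
  intro m hm
  rw [PowerSeries.coeff_derivative, h _ (by omega), zero_mul]

/-- The Lagrange series of `P ^ j P'` is an eigenvector of the Euler operator. -/
theorem coeff_lagrange_eigen {P G : PowerSeries ℂ} (h : IsUniformizer f ρ P G) (hf : f ≠ 0)
    (hρ : IsDetermination f ρ) (j : ℕ) {M : ℕ} {q : ℚ}
    (hq : q + 1 < ((M : ℚ) + 1) / ((tangency f : ℚ) + 1)) :
    ((j : ℂ) + 1) * (lagrange f ρ (M + 1) (P ^ j * PowerSeries.derivative ℂ P)).coeff q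
      = ((q + 1 : ℚ) : ℂ) * (((tangency f : ℂ) + 1) *
        (lagrange f ρ (M + 1) (P ^ j * PowerSeries.derivative ℂ P)).coeff q) := by
  have hκ : (0 : ℚ) < (tangency f : ℚ) + 1 := by positivity
  have h1 : f = ((tangency f : ℂ) + 1) • (P ^ tangency f * PowerSeries.derivative ℂ P) := by
    have h0 := derivative_primitive f
    rw [← h.pow_P, PowerSeries.derivative_pow, Nat.add_sub_cancel] at h0
    refine h0.symm.trans ?_
    rw [PowerSeries.smul_eq_C_mul]
    push_cast
    rw [map_add, map_natCast, map_one]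
    ring
  -- This links the two functional equations: with `Z = P^j P'` they combine, up to truncation
  -- errors, to `(j + 1) L(Z) = (κ + 1) ∂ (y L(Z))`.
  have h2 : f * P ^ (j + 1) = ((tangency f : ℂ) + 1) •
      (primitive f * (P ^ j * PowerSeries.derivative ℂ P)) := by
    rw [← h.pow_P, PowerSeries.smul_eq_C_mul]
    rw [PowerSeries.smul_eq_C_mul] at h1
    linear_combination P ^ (j + 1) * h1
  have h3 : PowerSeries.derivative ℂ (P ^ (j + 1))
      = ((j : ℂ) + 1) • (P ^ j * PowerSeries.derivative ℂ P) := by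
    rw [PowerSeries.derivative_pow, Nat.add_sub_cancel, PowerSeries.smul_eq_C_mul]
    push_cast
    rw [map_add, map_natCast, map_one]
    ring
  have h4 := congrArg (fun a => a.coeff q) (deriv_lagrange hf hρ M (P ^ (j + 1)))
  simp only [h3, map_smul, h2] at h4
  -- Both truncation errors start above the exponents in question, by the bound `hq`.
  rw [lagrange_primitive_mul hf hρ, coeff_deriv, HahnSeries.coeff_smul, HahnSeries.coeff_add,
    HahnSeries.coeff_add, coeff_single_one_mul, HahnSeries.coeff_smul, HahnSeries.coeff_smul,
    HahnSeries.coeff_smul, SupportGE.coeff_eq_zero (q := q + 1) (leadMap_supportGE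
      (k := (tangency f + 2) * (M + 1)) ?_ M) ?_, SupportGE.coeff_eq_zero (q := q)
      (leadMap_supportGE (k := (tangency f + 2) * M + (tangency f + 1)) ?_ (M + 1)) ?_] at h4
  · simp only [smul_eq_mul, mul_zero, add_zero] at h4
    exact h4.symm
  · rw [pow_add, pow_mul]
    exact (mul_dvd_mul (pow_dvd_pow_of_dvd X_pow_dvd_restPrim M)
      (X_pow_dvd_derivative X_pow_dvd_restPrim)).mul_right _
  · have : (((tangency f + 2) * M + (tangency f + 1) : ℕ) + 1 : ℚ) / ((tangency f : ℚ) + 1) - 1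
        - (M + 1 : ℕ) = ((M : ℚ) + 1) / ((tangency f : ℚ) + 1) - 1 := by
      push_cast
      field_simp
      ring
    rw [this]
    linarith
  · rw [pow_mul]
    exact (pow_dvd_pow_of_dvd X_pow_dvd_restPrim _).mul_right _
  · have : (((tangency f + 2) * (M + 1) : ℕ) + 1 : ℚ) / ((tangency f : ℚ) + 1) - 1 - M
        = ((M : ℚ) + 1) / ((tangency f : ℚ) + 1) + 1 / ((tangency f : ℚ) + 1) := by
      push_cast
      field_simp
      ring
    rw [this]
    have := root_pos (tangency f)
    linarith

theorem IsUniformizer.coeff_pow_mul_derivative {P G : PowerSeries ℂ} (h : IsUniformizer f ρ P G)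
    (j : ℕ) : (P ^ j * PowerSeries.derivative ℂ P).coeff j
      = (leadCoeff (tangency f) ρ)⁻¹ ^ (j + 1) := by
  obtain ⟨W, hW⟩ := PowerSeries.X_dvd_iff.2 h.const_P
  have h1 : PowerSeries.constantCoeff W = (leadCoeff (tangency f) ρ)⁻¹ := by
    rw [← h.coeff_P, hW, ← zero_add 1, PowerSeries.coeff_succ_X_mul,
      PowerSeries.coeff_zero_eq_constantCoeff_apply]
  have h2 : PowerSeries.constantCoeff (PowerSeries.derivative ℂ P)
      = (leadCoeff (tangency f) ρ)⁻¹ := by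
    rw [← PowerSeries.coeff_zero_eq_constantCoeff_apply, PowerSeries.coeff_derivative, zero_add,
      h.coeff_P]
    simp
  have h3 := PowerSeries.coeff_X_pow_mul (W ^ j * PowerSeries.derivative ℂ P) j 0
  rw [zero_add, ← mul_assoc, ← mul_pow, ← hW, PowerSeries.coeff_zero_eq_constantCoeff_apply] at h3
  rw [h3, map_mul, map_pow, h1, h2, pow_succ]

/-- The eigenvalue equation leaves a single possible exponent, and there only the summand `m = 0`
contributes, with the lowest coefficient of `P^j P'`. -/
theorem coeff_lagrange_pow {P G : PowerSeries ℂ} (h : IsUniformizer f ρ P G) (hf : f ≠ 0)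
    (hρ : IsDetermination f ρ) (j : ℕ) {M : ℕ} {q : ℚ}
    (hq : q + 1 < ((M : ℚ) + 1) / ((tangency f : ℚ) + 1)) :
    (lagrange f ρ (M + 1) (P ^ j * PowerSeries.derivative ℂ P)).coeff q
      = (HahnSeries.single (((j : ℚ) + 1) / ((tangency f : ℚ) + 1) - 1)
        (1 / ((tangency f : ℂ) + 1)) : Ramified).coeff q := by
  have hκ : (0 : ℚ) < (tangency f : ℚ) + 1 := by positivity
  by_cases hqj : q = ((j : ℚ) + 1) / ((tangency f : ℚ) + 1) - 1
  · rw [hqj, HahnSeries.coeff_single_same, lagrange_apply, Finset.sum_range_succ',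
      HahnSeries.coeff_add, HahnSeries.coeff_sum, Finset.sum_eq_zero, zero_add]
    · have hXP : PowerSeries.X ^ j ∣ P ^ j * PowerSeries.derivative ℂ P :=
        (pow_dvd_pow_of_dvd (PowerSeries.X_dvd_iff.2 h.const_P) j).mul_right _
      have hc := leadCoeff_ne_zero (κ := tangency f) (determination_ne_zero hf hρ)
      have h1 := HahnSeries.coeff_single_mul_add (a := (j : ℚ) / ((tangency f : ℚ) + 1))
        (b := 1 / ((tangency f : ℚ) + 1) - 1)
        (r := leadCoeff (tangency f) ρ / ((tangency f : ℂ) + 1))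
        (x := PowerSeries.heval (root (tangency f) (leadCoeff (tangency f) ρ))
          (P ^ j * PowerSeries.derivative ℂ P))
      simp only [pow_zero, Nat.factorial_zero, Nat.cast_one, div_one, one_smul, one_mul,
        Function.iterate_zero, id_eq]
      rw [leadMap_apply, deriv_root, add_div, add_sub_assoc, h1, coeff_heval_root,
        h.coeff_pow_mul_derivative, pow_succ, inv_pow]
      field_simp
    · intro m _
      rw [HahnSeries.coeff_smul, SupportGE.coeff_eq_zero (restPrim_supportGE (k := j) ?_ (m + 1)),
        smul_zero]
      · gcongr
        push_cast
        have : (0 : ℚ) ≤ m := by positivity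
        linarith
      · exact (pow_dvd_pow_of_dvd (PowerSeries.X_dvd_iff.2 h.const_P) j).mul_right _
  · rw [HahnSeries.coeff_single_of_ne hqj]
    have h1 := coeff_lagrange_eigen h hf hρ j hq
    rw [← mul_assoc, ← sub_eq_zero, ← sub_mul] at h1
    refine (mul_eq_zero.1 h1).resolve_left ?_
    intro h2
    apply hqj
    have h3 : ((j : ℚ) + 1) - (q + 1) * ((tangency f : ℚ) + 1) = 0 := by
      exact_mod_cast h2
    field_simp
    linarith

/-- Lagrange inversion: the Lagrange series of `H` is `∂(g*) H(g*)`. -/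
theorem coeff_lagrange (hf : f ≠ 0) (hρ : IsDetermination f ρ) {gs : Ramified}
    (hg : IsReciprocal f ρ gs) (H : PowerSeries ℂ) {M : ℕ} {q : ℚ}
    (hq : q + 1 < ((M : ℚ) + 1) / ((tangency f : ℚ) + 1)) :
    (lagrange f ρ (M + 1) H).coeff q = (deriv gs * PowerSeries.heval gs H).coeff q := by
  obtain ⟨P, G, h⟩ := exists_isUniformizer hf hρ
  have hκ : (0 : ℚ) < (tangency f : ℚ) + 1 := by positivity
  set L : PowerSeries ℂ →ₗ[ℂ] Ramified :=
    lagrange f ρ (M + 1) - LinearMap.mulLeft ℂ (deriv gs) ∘ₗ hevalₗ gs with hL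
  -- The difference of the two sides as a functional of `R`, where `H = R(P) P'`; on `R = X ^ j` it
  -- is the case already treated.
  set D : PowerSeries ℂ →ₗ[ℂ] ℂ := coeffₗ q ∘ₗ L ∘ₗ
    LinearMap.mulRight ℂ (PowerSeries.derivative ℂ P) ∘ₗ
    (PowerSeries.substAlgHom (R := ℂ) h.hasSubst_P).toLinearMap with hD
  have hDE : ∀ R : PowerSeries ℂ, D R
      = (lagrange f ρ (M + 1) (R.subst P * PowerSeries.derivative ℂ P)).coeff q
        - (deriv gs * PowerSeries.heval gs (R.subst P * PowerSeries.derivative ℂ P)).coeff q := by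
    intro R
    rw [← PowerSeries.coe_substAlgHom h.hasSubst_P]
    rfl
  have hgs : SupportGE (1 / ((tangency f : ℚ) + 1)) gs := by
    have := (root_supportGE (tangency f) 1).heval (root_pos _) (k := 1) (f := G)
      (by rw [pow_one, PowerSeries.X_dvd_iff, h.const_G])
    rw [hg.eq_heval h hf hρ]
    simpa using this
  obtain ⟨K, hK⟩ := exists_nat_gt ((q + 1) * ((tangency f : ℚ) + 1))
  have hK' : q < ((K : ℚ) + 1) / ((tangency f : ℚ) + 1) - 1 := by
    rw [lt_sub_iff_add_lt, lt_div_iff₀ hκ]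
    linarith
  have hzero : D = 0 := by
    refine functional_eq_zero (fun j => ?_) (M := K) fun R => ?_
    · rw [hDE, PowerSeries.subst_pow h.hasSubst_P, PowerSeries.subst_X h.hasSubst_P,
        coeff_lagrange_pow h hf hρ j hq, map_mul, map_pow, hg.heval_P h hf hρ, mul_left_comm,
        mul_comm (deriv gs), ← deriv_heval hg.pos, hg.heval_P h hf hρ, deriv_root, root_pow,
        HahnSeries.single_mul_single, one_pow, one_mul, add_div, add_sub_assoc, sub_self]
    · have hdvd : PowerSeries.X ^ K ∣
          PowerSeries.subst P (PowerSeries.X ^ K * R) * PowerSeries.derivative ℂ P := by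
        rw [PowerSeries.subst_mul h.hasSubst_P, PowerSeries.subst_pow h.hasSubst_P,
          PowerSeries.subst_X h.hasSubst_P, mul_assoc]
        exact (pow_dvd_pow_of_dvd (PowerSeries.X_dvd_iff.2 h.const_P) K).mul_right _
      rw [hDE, lagrange_apply, HahnSeries.coeff_sum, Finset.sum_eq_zero,
        (hgs.deriv.mul (hgs.heval (root_pos _) hdvd)).coeff_eq_zero, sub_zero]
      · rw [add_div] at hK'
        rw [mul_one_div]
        linarith
      · intro m _
        rw [HahnSeries.coeff_smul, (restPrim_supportGE hdvd m).coeff_eq_zero, smul_zero]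
        refine hK'.trans_le ?_
        gcongr
        have : (0 : ℚ) ≤ m := by positivity
        linarith
  have hP' : PowerSeries.constantCoeff (PowerSeries.derivative ℂ P) ≠ 0 := by
    have := h.coeff_pow_mul_derivative 0
    rw [pow_zero, one_mul, PowerSeries.coeff_zero_eq_constantCoeff_apply] at this
    rw [this]
    exact pow_ne_zero _ (inv_ne_zero (leadCoeff_ne_zero (determination_ne_zero hf hρ)))
  -- Every `H` has the form `R(P) P'`, with `R = (H / P') ∘ G`.
  have hR : PowerSeries.subst P (PowerSeries.subst G (H * (PowerSeries.derivative ℂ P)⁻¹))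
      * PowerSeries.derivative ℂ P = H := by
    rw [PowerSeries.subst_comp_subst_apply h.hasSubst_G h.hasSubst_P, h.subst_G,
      PowerSeries.X_subst, mul_assoc, PowerSeries.inv_mul_cancel _ hP', mul_one]
  have := hDE (PowerSeries.subst G (H * (PowerSeries.derivative ℂ P)⁻¹))
  rw [hzero, hR, LinearMap.zero_apply] at this
  exact (sub_eq_zero.1 this.symm)

end Lagrange

end

noncomputable section

/-! ### Expansion of the integrand of the nir-transform -/

/-- The ring homomorphism `∑ I ^ s z_s(x) ↦ ∑ N ^ s z_s(N τ)`. -/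
def diag : PowerSeries (PowerSeries ℂ) →+* PowerSeries (Polynomial ℂ) :=
  have hc : ∀ (z : PowerSeries (PowerSeries ℂ)) K p,
      (∑ p ∈ Finset.range (K + 1), Polynomial.monomial p ((z.coeff (K - p)).coeff p)).coeff p
        = if p ≤ K then (z.coeff (K - p)).coeff p else 0 := by
    intro z K p
    simp only [Polynomial.finsetSum_coeff, Polynomial.coeff_monomial, Finset.sum_ite_eq',
      Finset.mem_range, Nat.lt_succ_iff]
  { toFun := fun z => PowerSeries.mk fun K =>
      ∑ p ∈ Finset.range (K + 1), Polynomial.monomial p ((z.coeff (K - p)).coeff p)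
    map_zero' := by ext; simp
    map_one' := by
      ext K p
      rw [PowerSeries.coeff_mk, hc, PowerSeries.coeff_one, PowerSeries.coeff_one]
      by_cases hK : K = 0
      · subst hK
        by_cases hp : p = 0
        · subst hp; simp
        · rw [if_neg (by omega), if_pos rfl, Polynomial.coeff_one, if_neg hp]
      · rw [if_neg hK, Polynomial.coeff_zero]
        split_ifs with h1 h2
        · rw [PowerSeries.coeff_one, if_neg (by omega)]
        · simp
        · rfl
    map_add' := fun y z => by
      ext K p
      rw [map_add (PowerSeries.coeff K), Polynomial.coeff_add, PowerSeries.coeff_mk,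
        PowerSeries.coeff_mk, PowerSeries.coeff_mk, hc, hc, hc]
      split_ifs <;> simp
    map_mul' := fun y z => by
      ext K p
      rw [PowerSeries.coeff_mk, hc, PowerSeries.coeff_mul K, Polynomial.finsetSum_coeff]
      simp only [PowerSeries.coeff_mk, Polynomial.coeff_mul, hc]
      rw [Finset.sum_comm]
      split_ifs with hp
      · rw [PowerSeries.coeff_mul, map_sum]
        simp only [PowerSeries.coeff_mul]
        rw [Finset.sum_comm]
        refine Finset.sum_congr rfl fun pp hpp => ?_
        rw [Finset.HasAntidiagonal.mem_antidiagonal] at hpp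
        -- For fixed powers of `x`, pairs of powers of `I` are shifted to pairs of powers of `N`. A
        -- pair outside the image has more factors `τ` than `N` on one side and contributes zero.
        refine Finset.sum_of_injOn (fun ss => (ss.1 + pp.1, ss.2 + pp.2)) ?_ ?_ ?_ ?_
        · rintro ⟨a, b⟩ - ⟨a', b'⟩ - h
          simp only [Prod.mk.injEq] at h ⊢
          omega
        · rintro ⟨a, b⟩ h
          simp only [Finset.mem_coe, Finset.HasAntidiagonal.mem_antidiagonal] at h ⊢
          omega
        · rintro ⟨a, b⟩ h h'
          simp only [Finset.HasAntidiagonal.mem_antidiagonal] at h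
          by_cases h1 : pp.1 ≤ a
          · by_cases h2 : pp.2 ≤ b
            · refine absurd ?_ h'
              refine ⟨(a - pp.1, b - pp.2), ?_, ?_⟩
              · simp only [Finset.mem_coe, Finset.HasAntidiagonal.mem_antidiagonal]
                omega
              · simp only [Prod.mk.injEq]
                omega
            · rw [if_neg h2, mul_zero]
          · rw [if_neg h1, zero_mul]
        · rintro ⟨a, b⟩ h
          simp
      · refine (Finset.sum_eq_zero fun pp hpp => Finset.sum_eq_zero fun kk hkk => ?_).symm
        rw [Finset.HasAntidiagonal.mem_antidiagonal] at hpp hkk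
        beta_reduce
        by_cases h1 : pp.1 ≤ kk.1
        · rw [if_neg (show ¬ pp.2 ≤ kk.2 by omega), mul_zero]
        · rw [if_neg h1, zero_mul] }

theorem coeff_diag (z : PowerSeries (PowerSeries ℂ)) (K p : ℕ) :
    ((diag z).coeff K).coeff p = if p ≤ K then (z.coeff (K - p)).coeff p else 0 := by
  change (PowerSeries.coeff K (PowerSeries.mk fun K =>
    ∑ p ∈ Finset.range (K + 1), Polynomial.monomial p ((z.coeff (K - p)).coeff p))).coeff p = _
  rw [PowerSeries.coeff_mk]
  simp only [Polynomial.finsetSum_coeff, Polynomial.coeff_monomial, Finset.sum_ite_eq',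
    Finset.mem_range, Nat.lt_succ_iff]

theorem constantCoeff_diag {z : PowerSeries (PowerSeries ℂ)}
    (hz : PowerSeries.constantCoeff z = 0) : PowerSeries.constantCoeff (diag z) = 0 := by
  ext p
  rw [← PowerSeries.coeff_zero_eq_constantCoeff_apply, coeff_diag]
  split_ifs with h
  · rw [Nat.zero_sub, PowerSeries.coeff_zero_eq_constantCoeff_apply, hz]
    simp
  · rfl

/-- `diag` mixes the two gradings and is not a coefficientwise map, so `expSharp_map` does not
apply; the finite sums defining the coefficients are compared directly. -/
theorem expSharp_diag {z : PowerSeries (PowerSeries ℂ)}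
    (hz : PowerSeries.constantCoeff z = 0) : expSharp (diag z) = diag (expSharp z) := by
  ext K p
  rw [coeff_expSharp (constantCoeff_diag hz) (Nat.lt_succ_self K), coeff_diag,
    Polynomial.finsetSum_coeff]
  simp only [Polynomial.coeff_smul, ← map_pow, coeff_diag]
  split_ifs with h
  · rw [coeff_expSharp hz (M := K + 1) (by omega), map_sum]
    refine Finset.sum_congr rfl fun m _ => ?_
    exact (map_rat_smul (PowerSeries.coeff p : PowerSeries ℂ →ₗ[ℂ] ℂ) _ _).symm
  · simp

/-- The exponent `∑_{r ≥ 1} β_r I ^ r f^{(r)}(x)`. -/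
def derivExponent (β : LaurentSeries ℂ) (f : PowerSeries ℂ) : PowerSeries (PowerSeries ℂ) :=
  PowerSeries.mk fun r =>
    if r = 0 then 0 else β.coeff (r : ℤ) • (PowerSeries.derivative ℂ)^[r] f

theorem constantCoeff_derivExponent (β : LaurentSeries ℂ) (f : PowerSeries ℂ) :
    PowerSeries.constantCoeff (derivExponent β f) = 0 := by
  rw [← PowerSeries.coeff_zero_eq_constantCoeff_apply, derivExponent, PowerSeries.coeff_mk,
    if_pos rfl]

/-- The coefficients of `exp_# (-∑_{r ≥ 1} β_r I ^ r f^{(r)}(x))`. -/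
def derivSymbol (β : LaurentSeries ℂ) (f : PowerSeries ℂ) (s : ℕ) : PowerSeries ℂ :=
  (expSharp (-derivExponent β f)).coeff s

theorem coeff_betaStar (β : LaurentSeries ℂ) (k p : ℕ) :
    (betaStar β k).coeff p = if p ≤ k + 1 then
      β.coeff ((k : ℤ) - p) * ((k.factorial : ℂ) / (p.factorial : ℂ)) else 0 := by
  rw [betaStar, Polynomial.finsetSum_coeff]
  simp only [Polynomial.coeff_C_mul, Polynomial.coeff_X_pow]
  split_ifs with h
  · rw [Finset.sum_eq_single (k + 1 - p)]
    · rw [if_pos (by omega), mul_one]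
      have h1 : ((k + 1 - p : ℕ) : ℤ) - 1 = (k : ℤ) - p := by omega
      have h2 : k + 1 - (k + 1 - p) = p := by omega
      rw [h1, h2]
    · intro j hj hjp
      rw [Finset.mem_range] at hj
      rw [if_neg (by omega), mul_zero]
    · intro hc
      rw [Finset.mem_range] at hc
      omega
  · refine Finset.sum_eq_zero fun j hj => ?_
    rw [if_neg (by omega), mul_zero]

theorem coeff_iterate_derivative_eq (f : PowerSeries ℂ) (r p : ℕ) :
    ((PowerSeries.derivative ℂ)^[r] f).coeff p
      = f.coeff (p + r) * (((p + r).factorial : ℂ) / (p.factorial : ℂ)) := by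
  induction r generalizing p with
  | zero =>
    have : (p.factorial : ℂ) ≠ 0 := by exact_mod_cast p.factorial_ne_zero
    simp [this]
  | succ r ih =>
    rw [Function.iterate_succ_apply', PowerSeries.coeff_derivative, ih,
      show p + 1 + r = p + (r + 1) by ring, Nat.factorial_succ p]
    have h1 : (p.factorial : ℂ) ≠ 0 := by exact_mod_cast p.factorial_ne_zero
    have h2 : (p : ℂ) + 1 ≠ 0 := by exact_mod_cast p.succ_ne_zero
    push_cast
    field_simp

/-- `N (fUp - ∑ β_r N ^ r f^{(r)}(N τ))` is `f*(N τ)` without its leading term. -/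
theorem X_mul_fUp_sub {β : LaurentSeries ℂ} (hβ : IsAdmissible β) (f : PowerSeries ℂ) :
    PowerSeries.X * (fUp β f - diag (derivExponent β f))
      = diag (PowerSeries.C (restPrim f)) := by
  ext K p
  rcases K with _ | K
  · rw [coeff_diag, PowerSeries.coeff_zero_X_mul]
    split_ifs with h
    · obtain rfl : p = 0 := by omega
      rw [Nat.zero_sub, PowerSeries.coeff_zero_C, PowerSeries.X_pow_dvd_iff.1 X_pow_dvd_restPrim 0
        (by omega), Polynomial.coeff_zero]
    · rfl
  · rw [coeff_diag, PowerSeries.coeff_succ_X_mul, map_sub, Polynomial.coeff_sub, coeff_diag, fUp,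
      map_sub, Polynomial.coeff_sub, fUpUp, PowerSeries.coeff_mk, Polynomial.coeff_C_mul,
      coeff_betaStar, derivExponent, PowerSeries.coeff_mk, PowerSeries.coeff_monomial,
      PowerSeries.coeff_C]
    have hK : (K.factorial : ℂ) ≠ 0 := by exact_mod_cast K.factorial_ne_zero
    rcases lt_trichotomy p (K + 1) with h | rfl | h
    · have hz : (if K = tangency f then Polynomial.C (f.coeff (tangency f) /
          ((tangency f : ℂ) + 1)) * Polynomial.X ^ (tangency f + 1) else 0).coeff p = 0 := by
        split_ifs with h1
        · rw [Polynomial.coeff_C_mul, Polynomial.coeff_X_pow, if_neg (by omega), mul_zero]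
        · rfl
      rw [hz, if_pos (show p ≤ K + 1 by omega), if_pos (show p ≤ K by omega),
        if_pos (show p ≤ K + 1 by omega),
        if_neg (show K + 1 - p ≠ 0 by omega), sub_zero, map_zero]
      rcases eq_or_ne p K with rfl | hpK
      -- The terms `N^K τ^K` carry the factor `β_0 = 0`.
      · rw [if_pos (by omega), sub_self, hβ.coeff_zero]
        simp
      · obtain ⟨r, rfl⟩ : ∃ r, K = p + r := ⟨K - p, by omega⟩
        rw [Nat.add_sub_cancel_left, if_neg (by omega), PowerSeries.coeff_smul,
          coeff_iterate_derivative_eq]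
        push_cast
        rw [add_sub_cancel_left, smul_eq_mul]
        ring
    · rw [if_pos le_rfl, if_pos le_rfl, if_neg (show ¬ K + 1 ≤ K by omega), Nat.sub_self,
        if_pos rfl, restPrim, map_sub, coeff_primitive_succ, leadPrim, PowerSeries.coeff_C_mul,
        PowerSeries.coeff_X_pow, sub_zero]
      -- The terms `N^K τ^(K+1)` carry `β_{-1} = 1` and form `n f*(N τ)`.
      have h1 : (K : ℤ) - ((K + 1 : ℕ) : ℤ) = -1 := by push_cast; ring
      rw [h1, hβ.coeff_neg_one, Nat.factorial_succ]
      congr 1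
      · push_cast
        field_simp
      · split_ifs with h1 h2 h2
        · subst h1; simp
        · omega
        · omega
        · simp
    · have hz : (if K = tangency f then Polynomial.C (f.coeff (tangency f) /
          ((tangency f : ℂ) + 1)) * Polynomial.X ^ (tangency f + 1) else 0).coeff p = 0 := by
        split_ifs with h1
        · rw [Polynomial.coeff_C_mul, Polynomial.coeff_X_pow, if_neg (by omega), mul_zero]
        · rfl
      rw [hz, if_neg (show ¬ p ≤ K + 1 by omega), if_neg (show ¬ p ≤ K by omega),
        if_neg (show ¬ p ≤ K + 1 by omega)]
      simp

/-- The exponent is `A + diag(derivExponent)` up to sign, where `N A = w(N τ)`. Hence the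
coefficient of `N^K` in `A^m` times the second exponential is a coefficient of `N^(K+m)` in a
`diag`, which avoids negative powers of `N`. -/
theorem coeff_expSharp_fUp {β : LaurentSeries ℂ} (hβ : IsAdmissible β) (f : PowerSeries ℂ)
    {K M : ℕ} (hM : K < M) (p : ℕ) :
    ((expSharp (-fUp β f)).coeff K).coeff p = ∑ m ∈ Finset.range M,
      if p ≤ K + m then ((-1 : ℂ) ^ m / (m.factorial : ℂ)) *
        (restPrim f ^ m * derivSymbol β f (K + m - p)).coeff p else 0 := by
  set A := fUp β f - diag (derivExponent β f) with hA
  have hXA := X_mul_fUp_sub hβ f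
  rw [← hA] at hXA
  have hA0 : PowerSeries.constantCoeff (-A) = 0 := by
    rw [map_neg, neg_eq_zero]
    have := congrArg (PowerSeries.coeff 1) hXA
    rw [← zero_add 1, PowerSeries.coeff_succ_X_mul,
      PowerSeries.coeff_zero_eq_constantCoeff_apply] at this
    rw [this]
    ext p
    rw [coeff_diag]
    split_ifs with h
    · rw [PowerSeries.coeff_C]
      split_ifs with h1
      · rw [PowerSeries.X_pow_dvd_iff.1 X_pow_dvd_restPrim p (by omega), Polynomial.coeff_zero]
      · simp
    · rfl
  have hY0 : PowerSeries.constantCoeff (-derivExponent β f) = 0 := by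
    rw [map_neg, constantCoeff_derivExponent, neg_zero]
  have hsplit : expSharp (-fUp β f) = expSharp (-A) * diag (expSharp (-derivExponent β f)) := by
    rw [← expSharp_diag hY0, ← expSharp_add hA0 (constantCoeff_diag hY0), map_neg]
    congr 1
    rw [hA]
    ring
  have hmul : ∀ m, (A ^ m * diag (expSharp (-derivExponent β f))).coeff K
      = (diag (PowerSeries.C (restPrim f ^ m) * expSharp (-derivExponent β f))).coeff (K + m) := by
    intro m
    rw [map_mul diag, map_pow PowerSeries.C, map_pow diag, ← hXA, mul_pow, mul_assoc,
      PowerSeries.coeff_X_pow_mul]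
  have hexp : (expSharp (-fUp β f)).coeff K = ∑ m ∈ Finset.range M, (1 / (m.factorial : ℚ)) •
      ((-A) ^ m * diag (expSharp (-derivExponent β f))).coeff K := by
    rw [hsplit, PowerSeries.coeff_mul]
    simp only [PowerSeries.coeff_mul, Finset.smul_sum]
    rw [Finset.sum_comm]
    refine Finset.sum_congr rfl fun ij hij => ?_
    rw [Finset.HasAntidiagonal.mem_antidiagonal] at hij
    rw [coeff_expSharp hA0 (M := M) (by omega), Finset.sum_mul]
    exact Finset.sum_congr rfl fun m _ => smul_mul_assoc _ _ _
  rw [hexp, Polynomial.finsetSum_coeff]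
  refine Finset.sum_congr rfl fun m _ => ?_
  rw [Polynomial.coeff_smul, neg_pow, mul_assoc, ← map_one PowerSeries.C, ← map_neg, ← map_pow,
    PowerSeries.coeff_C_mul, hmul, ← map_one Polynomial.C, ← map_neg, ← map_pow,
    Polynomial.coeff_C_mul, coeff_diag, PowerSeries.coeff_C_mul, Algebra.smul_def]
  split_ifs with h
  · rw [derivSymbol, ← mul_assoc]
    congr 1
    simp
    ring
  · simp

end

noncomputable section

/-! ### The terms of the nir-transform -/

theorem iterate_deriv_coeff (m : ℕ) (q : ℚ) :
    ∃ μ : ℂ, ∀ a : Ramified, (deriv^[m] a).coeff q = μ * a.coeff (q + m) := by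
  induction m generalizing q with
  | zero => exact ⟨1, fun a => by simp⟩
  | succ m ih =>
    obtain ⟨μ, hμ⟩ := ih (q + 1)
    refine ⟨((q + 1 : ℚ) : ℂ) * μ, fun a => ?_⟩
    rw [Function.iterate_succ_apply', coeff_deriv, hμ, mul_assoc]
    push_cast
    rw [add_right_comm, add_assoc]

theorem iterate_integ_coeff (s : ℕ) (q : ℚ) :
    ∃ μ : ℂ, ∀ a : Ramified, (integ^[s] a).coeff q = μ * a.coeff (q - s) := by
  induction s generalizing q with
  | zero => exact ⟨1, fun a => by simp⟩
  | succ s ih =>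
    obtain ⟨μ, hμ⟩ := ih (q - 1)
    refine ⟨μ / ((q : ℚ) : ℂ), fun a => ?_⟩
    rw [Function.iterate_succ_apply', coeff_integ, hμ]
    push_cast
    rw [sub_sub, add_comm (1 : ℚ)]
    ring

/-- Multiplication by `n⁻¹` is integration in `ν`, because `Γ(q + 2) = (q + 1) Γ(q + 1)`. -/
theorem integ_laplaceBorel (κ : ℕ) (ρ : ℂ) (K p : ℕ)
    (h : (K : ℚ) - κ * (((p : ℚ) + 1) / ((κ : ℚ) + 1)) + 1 ≠ 0) :
    integ (laplaceBorel κ ρ K p) = laplaceBorel κ ρ (K + 1) p := by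
  rw [laplaceBorel, laplaceBorel]
  rw [integ_single]
  set σ : ℚ := ((p : ℚ) + 1) / ((κ : ℚ) + 1) with hσ
  have hq : ((K + 1 : ℕ) : ℚ) - κ * σ = (K - κ * σ) + 1 := by push_cast; ring
  rw [hq, mul_div_assoc]
  congr 2
  have h' : (((K - κ * σ : ℚ) : ℝ) + 1) ≠ 0 := by exact_mod_cast h
  have h2 : (((K - κ * σ + 1 : ℚ) : ℝ) + 1) = (((K - κ * σ : ℚ) : ℝ) + 1) + 1 := by push_cast; ring
  rw [h2, Real.Gamma_add_one h']
  push_cast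
  rw [div_div, mul_comm (Complex.ofReal (Real.Gamma (_ + 1)))]

theorem deriv_laplaceBorel (κ : ℕ) (ρ : ℂ) (K p : ℕ)
    (h : (K : ℚ) - κ * (((p : ℚ) + 1) / ((κ : ℚ) + 1)) + 1 ≠ 0) :
    deriv (laplaceBorel κ ρ (K + 1) p) = laplaceBorel κ ρ K p := by
  rw [← integ_laplaceBorel κ ρ K p h, laplaceBorel]
  rw [integ_single, deriv_single, add_sub_cancel_right]
  congr 1
  rw [mul_div_cancel₀]
  exact_mod_cast h

/-- For `(τ / n)^p` the Gamma factors of the Laplace and Borel integrals cancel, and the result is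
`∂x₀ · x₀^p`. This is where the double integral meets the Lagrange series. -/
theorem laplaceBorel_self (κ : ℕ) (ρ : ℂ) (p : ℕ) :
    laplaceBorel κ ρ p p = HahnSeries.single (((p : ℚ) + 1) / ((κ : ℚ) + 1) - 1)
      (leadCoeff κ ρ ^ (p + 1) / ((κ : ℂ) + 1)) := by
  rw [laplaceBorel]
  set σ : ℚ := ((p : ℚ) + 1) / ((κ : ℚ) + 1) with hσ
  have hκ : (0 : ℚ) < (κ : ℚ) + 1 := by positivity
  have hκ' : (0 : ℝ) < (κ : ℝ) + 1 := by positivity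
  have hq : (p : ℚ) - κ * σ = σ - 1 := by
    rw [hσ]; field_simp; ring
  have hσ0 : (0 : ℝ) < (σ : ℝ) := by
    have : 0 < σ := by positivity
    exact_mod_cast this
  rw [hq]
  congr 1
  have h1 : ((σ - 1 : ℚ) : ℝ) + 1 = (σ : ℝ) := by push_cast; ring
  rw [h1, mul_div_cancel_right₀ _ (Real.Gamma_pos_of_pos hσ0).ne', leadCoeff, div_pow,
    ← Complex.ofReal_pow, ← Real.rpow_natCast, ← Real.rpow_mul hκ'.le, Real.rpow_sub hκ',
    Real.rpow_one]
  have h2 : 1 / ((κ : ℝ) + 1) * ((p + 1 : ℕ) : ℝ) = (σ : ℝ) := by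
    rw [hσ]; push_cast; field_simp
  rw [h2]
  push_cast
  rw [div_div, div_eq_mul_inv, div_eq_mul_inv, mul_inv]
  ring

theorem iterate_deriv_laplaceBorel (κ : ℕ) (ρ : ℂ) (p m : ℕ) (h : m * (κ + 1) < p + 1) :
    deriv^[m] (laplaceBorel κ ρ p p) = laplaceBorel κ ρ (p - m) p := by
  induction m with
  | zero => rfl
  | succ m ih =>
    have h1 : m * (κ + 1) < p + 1 := by nlinarith
    have h2 : m + 1 ≤ p := by nlinarith
    rw [Function.iterate_succ_apply', ih h1]
    obtain ⟨k, rfl⟩ := Nat.exists_eq_add_of_le' h2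
    have e1 : k + (m + 1) - m = k + 1 := by omega
    have e2 : k + (m + 1) - (m + 1) = k := by omega
    rw [e1, e2, deriv_laplaceBorel]
    have h3 : ((m : ℚ) + 1) * (κ + 1) < k + (m + 1) + 1 := by exact_mod_cast h
    have hκ : (0 : ℚ) < (κ : ℚ) + 1 := by positivity
    apply ne_of_gt
    have h4 : (k : ℚ) - κ * ((((k + (m + 1) : ℕ) : ℚ) + 1) / ((κ : ℚ) + 1)) + 1
        = (k + (m + 1) + 1 - (m + 1) * (κ + 1)) / ((κ : ℚ) + 1) := by
      push_cast
      field_simp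
      ring
    rw [h4]
    apply div_pos _ hκ
    linarith

theorem iterate_integ_laplaceBorel (κ : ℕ) (ρ : ℂ) (K p s : ℕ)
    (h : 0 < (K : ℚ) - κ * (((p : ℚ) + 1) / ((κ : ℚ) + 1)) + 1) :
    integ^[s] (laplaceBorel κ ρ K p) = laplaceBorel κ ρ (K + s) p := by
  induction s with
  | zero => rfl
  | succ s ih =>
    rw [Function.iterate_succ_apply', ih, integ_laplaceBorel]
    · rfl
    · push_cast
      have : (0 : ℚ) ≤ s := by positivity
      linarith

/-- The hypothesis keeps all exponents above `-1` during the `m` derivatives, so the Gamma recursion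
never meets a pole and `p + s - m` is a true subtraction. -/
theorem iterate_integ_iterate_deriv_laplaceBorel (κ : ℕ) (ρ : ℂ) (m s p : ℕ)
    (h : m * (κ + 1) < p + 1) :
    integ^[s] (deriv^[m] (laplaceBorel κ ρ p p)) = laplaceBorel κ ρ (p + s - m) p := by
  have hm : m ≤ p := by nlinarith
  rw [iterate_deriv_laplaceBorel κ ρ p m h, iterate_integ_laplaceBorel]
  · congr 1
    omega
  · have h3 : (m : ℚ) * (κ + 1) < p + 1 := by exact_mod_cast h
    have hκ : (0 : ℚ) < (κ : ℚ) + 1 := by positivity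
    have h4 : ((p - m : ℕ) : ℚ) - κ * (((p : ℚ) + 1) / ((κ : ℚ) + 1)) + 1
        = (p + 1 - m * (κ + 1)) / ((κ : ℚ) + 1) := by
      rw [Nat.cast_sub hm]
      field_simp
      ring
    rw [h4]
    apply div_pos _ hκ
    linarith

variable {f : PowerSeries ℂ} {ρ : ℂ}

theorem coeff_leadMap (H : PowerSeries ℂ) {B : ℕ} {q : ℚ}
    (hB : (q + 1) * ((tangency f : ℚ) + 1) ≤ B) :
    (leadMap f ρ H).coeff q
      = ∑ p ∈ Finset.range B, H.coeff p * (laplaceBorel (tangency f) ρ p p).coeff q := by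
  have hκ : (0 : ℚ) < (tangency f : ℚ) + 1 := by positivity
  simp only [laplaceBorel_self]
  by_cases hq : ∃ p : ℕ, q = ((p : ℚ) + 1) / ((tangency f : ℚ) + 1) - 1
  · obtain ⟨p, rfl⟩ := hq
    rw [Finset.sum_eq_single p]
    · have h1 := HahnSeries.coeff_single_mul_add (a := (p : ℚ) / ((tangency f : ℚ) + 1))
        (b := 1 / ((tangency f : ℚ) + 1) - 1)
        (r := leadCoeff (tangency f) ρ / ((tangency f : ℂ) + 1))
        (x := PowerSeries.heval (root (tangency f) (leadCoeff (tangency f) ρ)) H)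
      rw [HahnSeries.coeff_single_same, leadMap_apply, deriv_root, add_div, add_sub_assoc, h1,
        coeff_heval_root]
      ring
    · intro p' _ hp'
      rw [HahnSeries.coeff_single_of_ne, mul_zero]
      intro h
      field_simp at h
      apply hp'
      have : (p : ℚ) = p' := by linarith
      exact_mod_cast this.symm
    · intro hp
      exfalso
      rw [Finset.mem_range, not_lt] at hp
      have : (B : ℚ) ≤ p := by exact_mod_cast hp
      rw [sub_add_cancel, div_mul_cancel₀ _ hκ.ne'] at hB
      linarith
  · rw [Finset.sum_eq_zero]
    · by_contra hc
      refine hq (onLattice_mul_heval_root (tangency f) (leadCoeff (tangency f) ρ)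
        (leadCoeff (tangency f) ρ / ((tangency f : ℂ) + 1)) H q ?_)
      rwa [leadMap_apply, deriv_root] at hc
    · intro p _
      rw [HahnSeries.coeff_single_of_ne, mul_zero]
      exact fun h => hq ⟨p, h⟩

/-- The terms of the common refinement of the series for `nir` and of the formula for `mir`. -/
def refinedTerm (β : LaurentSeries ℂ) (f : PowerSeries ℂ) (ρ : ℂ) (i : ℕ × ℕ × ℕ) : Ramified :=
  (((-1 : ℂ) ^ i.1 / (i.1.factorial : ℂ)) * (restPrim f ^ i.1 * derivSymbol β f i.2.1).coeff i.2.2)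
    • laplaceBorel (tangency f) ρ (i.2.2 + i.2.1 - i.1) i.2.2

/-- Nonzero terms have `p ≥ (κ + 2) m`; in particular the subtraction of `m` in `refinedTerm` is
never truncated for them. -/
theorem coeff_restPrim_pow_mul {m p : ℕ} {H : PowerSeries ℂ}
    (h : (restPrim f ^ m * H).coeff p ≠ 0) : (tangency f + 2) * m ≤ p := by
  by_contra! hc
  refine h (PowerSeries.X_pow_dvd_iff.1 ?_ p hc)
  rw [pow_mul]
  exact (pow_dvd_pow_of_dvd X_pow_dvd_restPrim m).mul_right _

theorem refinedTerm_coeff_ne_zero {β : LaurentSeries ℂ} {m s p : ℕ} {q : ℚ}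
    (h : (refinedTerm β f ρ (m, s, p)).coeff q ≠ 0) :
    (tangency f + 2) * m ≤ p ∧ q = ((p : ℚ) + 1) / ((tangency f : ℚ) + 1) - 1 - m + s := by
  have hκ : (0 : ℚ) < (tangency f : ℚ) + 1 := by positivity
  rw [refinedTerm, HahnSeries.coeff_smul, smul_eq_mul] at h
  have h1 := coeff_restPrim_pow_mul (right_ne_zero_of_mul (left_ne_zero_of_mul h))
  refine ⟨h1, ?_⟩
  have h2 := right_ne_zero_of_mul h
  rw [laplaceBorel] at h2
  by_contra hq
  refine h2 (HahnSeries.coeff_single_of_ne ?_)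
  have h3 : m ≤ p + s := by simp only at h1; nlinarith
  convert hq using 1
  simp only
  rw [Nat.cast_sub h3]
  push_cast
  field_simp
  ring

/-- From `(q + 1 + m - s)(κ + 1) = p + 1` and `p ≥ (κ + 2) m` one gets `m + 1 ≤ (q + 1 - s)(κ + 1)`.
This bounds `s` and `m`, and then `p`. -/
theorem refinedTerm_finite (β : LaurentSeries ℂ) (q : ℚ) :
    {i | (refinedTerm β f ρ i).coeff q ≠ 0}.Finite := by
  have hκ : (0 : ℚ) < (tangency f : ℚ) + 1 := by positivity
  obtain ⟨B, hB⟩ := exists_nat_gt ((q + 1) * ((tangency f : ℚ) + 1))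
  obtain ⟨C, hC⟩ := exists_nat_gt (q + 1)
  obtain ⟨D, hD⟩ := exists_nat_gt ((q + 1 + B) * ((tangency f : ℚ) + 1))
  refine ((Finset.range B ×ˢ Finset.range C ×ˢ Finset.range D).finite_toSet).subset ?_
  rintro ⟨m, s, p⟩ h
  obtain ⟨h1, h2⟩ := refinedTerm_coeff_ne_zero h
  have h1' : ((tangency f : ℚ) + 2) * m ≤ p := by exact_mod_cast h1
  have h3 : (q + 1 + m - s) * ((tangency f : ℚ) + 1) = p + 1 := by
    rw [h2]; field_simp; ring
  have hm0 : (0 : ℚ) ≤ m := by positivity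
  have hs0 : (0 : ℚ) ≤ s := by positivity
  have hm : m < B := by
    have : (m : ℚ) < B := by nlinarith
    exact_mod_cast this
  have hs : s < C := by
    have : 0 < (q + 1 - s) * ((tangency f : ℚ) + 1) := by nlinarith
    have := pos_of_mul_pos_left this hκ.le
    have : (s : ℚ) < C := by linarith
    exact_mod_cast this
  have hp : p < D := by
    have h4 : (m : ℚ) < B := by exact_mod_cast hm
    have : (p : ℚ) < D := by nlinarith
    exact_mod_cast this
  simp only [Finset.coe_product, Set.mem_prod, Finset.mem_coe, Finset.mem_range]
  exact ⟨hm, hs, hp⟩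

theorem refinedTerm_onLattice (β : LaurentSeries ℂ) (i : ℕ × ℕ × ℕ) :
    OnLattice (tangency f) (refinedTerm β f ρ i) := by
  obtain ⟨m, s, p⟩ := i
  intro q hq
  obtain ⟨h1, h2⟩ := refinedTerm_coeff_ne_zero hq
  have hκ : (0 : ℚ) < (tangency f : ℚ) + 1 := by positivity
  have h3 : m * (tangency f + 1) ≤ p + s * (tangency f + 1) := by nlinarith
  refine ⟨p + s * (tangency f + 1) - m * (tangency f + 1), ?_⟩
  rw [h2, Nat.cast_sub h3]
  push_cast
  field_simp
  ring

theorem exists_hasFormalSum_refinedTerm (β : LaurentSeries ℂ) :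
    ∃ a, HasFormalSum (refinedTerm β f ρ) a :=
  exists_hasFormalSum_of_onLattice (tangency f) (refinedTerm_onLattice β) (refinedTerm_finite β)

/-- Sum over the triples that produce the same monomial `n^(-K) τ^p`, namely those with `p + s - m =
K`. -/
theorem hasFormalSum_nirTerm {β : LaurentSeries ℂ} (hβ : IsAdmissible β) {a : Ramified}
    (h : HasFormalSum (refinedTerm β f ρ) a) : HasFormalSum (nirTerm β f ρ) a := by
  refine h.fiberwise (fun i => (i.2.2 + i.2.1 - i.1, i.2.2)) ?_
  rintro ⟨K, p⟩ q
  rw [nirTerm, HahnSeries.coeff_smul, coeff_expSharp_fUp hβ f (Nat.lt_succ_self K)]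
  have hinj : Set.InjOn (fun m => ((m, K + m - p, p) : ℕ × ℕ × ℕ))
      ↑((Finset.range (K + 1)).filter fun m => p ≤ K + m) := by
    intro m _ m' _ hmm
    simp only [Prod.mk.injEq] at hmm
    exact hmm.1
  rw [finsum_mem_eq_sum_of_inter_support_eq (t := ((Finset.range (K + 1)).filter
    fun m => p ≤ K + m).image fun m => ((m, K + m - p, p) : ℕ × ℕ × ℕ)),
    Finset.sum_image hinj, Finset.sum_filter, smul_eq_mul, Finset.sum_mul]
  · refine Finset.sum_congr rfl fun m _ => ?_
    split_ifs with hm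
    · rw [refinedTerm, HahnSeries.coeff_smul, smul_eq_mul]
      simp only
      have : p + (K + m - p) - m = K := by omega
      rw [this]
    · rw [zero_mul]
  · ext ⟨m, s, p'⟩
    simp only [Set.mem_inter_iff, Set.mem_ofPred_eq, Prod.mk.injEq, Function.mem_support,
      Finset.coe_image, Finset.coe_filter, Finset.mem_range, Set.mem_image]
    constructor
    · rintro ⟨⟨h1, rfl⟩, h2⟩
      refine ⟨⟨m, ⟨?_, ?_⟩, rfl, ?_, rfl⟩, h2⟩
      all_goals
        have h3 := (refinedTerm_coeff_ne_zero h2).1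
        have h4 : m + m ≤ p' := by nlinarith
        omega
    · rintro ⟨⟨m, ⟨h1, h2⟩, rfl, rfl, rfl⟩, h3⟩
      exact ⟨⟨by omega, rfl⟩, h3⟩

/-- Sum over the triples of the same order `s`: the fibre is the `s`-fold integral of a Lagrange
series, evaluated by `coeff_lagrange`. -/
theorem hasFormalSum_derivSymbol {β : LaurentSeries ℂ} (hf : f ≠ 0)
    (hρ : IsDetermination f ρ) {gs : Ramified} (hg : IsReciprocal f ρ gs) {a : Ramified}
    (h : HasFormalSum (refinedTerm β f ρ) a) :
    HasFormalSum
      (fun s : ℕ => integ^[s] (deriv gs * PowerSeries.heval gs (derivSymbol β f s))) a := by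
  have hκ : (0 : ℚ) < (tangency f : ℚ) + 1 := by positivity
  refine h.fiberwise (fun i => i.2.1) fun s q => ?_
  -- `M` bounds the powers of `restPrim f`, and `B` below the powers of `x`, that can reach the
  -- exponent `q` at order `s`.
  obtain ⟨M, hM⟩ := exists_nat_gt ((q - s + 1) * ((tangency f : ℚ) + 1))
  obtain ⟨B, hB⟩ := exists_nat_gt ((q - s + M + 1) * ((tangency f : ℚ) + 1))
  obtain ⟨μ, hμ⟩ := iterate_integ_coeff s q
  have hM' : q - s + 1 < ((M : ℚ) + 1) / ((tangency f : ℚ) + 1) := by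
    rw [lt_div_iff₀ hκ]; linarith
  have hinj : Set.InjOn (fun x : ℕ × ℕ => ((x.1, s, x.2) : ℕ × ℕ × ℕ))
      ↑(Finset.range (M + 1) ×ˢ Finset.range B) := by
    rintro ⟨m, p⟩ _ ⟨m', p'⟩ _ hmm
    simpa using hmm
  rw [finsum_mem_eq_sum_of_inter_support_eq (t := (Finset.range (M + 1) ×ˢ Finset.range B).image
    fun x : ℕ × ℕ => ((x.1, s, x.2) : ℕ × ℕ × ℕ)), Finset.sum_image hinj, Finset.sum_product]
  · rw [hμ, ← coeff_lagrange hf hρ hg _ hM', lagrange_apply, HahnSeries.coeff_sum, Finset.mul_sum]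
    refine Finset.sum_congr rfl fun m hm => ?_
    obtain ⟨μ', hμ'⟩ := iterate_deriv_coeff m (q - s)
    have hmM : (m : ℚ) ≤ M := by exact_mod_cast Nat.lt_succ_iff.1 (Finset.mem_range.1 hm)
    rw [HahnSeries.coeff_smul, hμ', coeff_leadMap (B := B) _ (by nlinarith), smul_eq_mul,
      Finset.mul_sum, Finset.mul_sum, Finset.mul_sum]
    refine Finset.sum_congr rfl fun p _ => ?_
    rw [refinedTerm, HahnSeries.coeff_smul, smul_eq_mul]
    simp only
    by_cases hc : (restPrim f ^ m * derivSymbol β f s).coeff p = 0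
    · rw [hc]; ring
    · have h1 := coeff_restPrim_pow_mul hc
      rw [← iterate_integ_iterate_deriv_laplaceBorel _ _ _ _ _ (by nlinarith), hμ, hμ']
      ring
  · ext ⟨m, s', p⟩
    simp only [Set.mem_inter_iff, Set.mem_ofPred_eq, Function.mem_support, Finset.coe_image,
      Set.mem_image, Finset.mem_coe, Finset.mem_product, Finset.mem_range, Prod.mk.injEq,
      Prod.exists]
    constructor
    · rintro ⟨rfl, h2⟩
      refine ⟨⟨m, p, ⟨?_, ?_⟩, rfl, rfl, rfl⟩, h2⟩
      all_goals
        obtain ⟨h3, h4⟩ := refinedTerm_coeff_ne_zero h2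
        have h1' : ((tangency f : ℚ) + 2) * m ≤ p := by exact_mod_cast h3
        have h5 : (q - s' + 1 + m) * ((tangency f : ℚ) + 1) = p + 1 := by
          rw [h4]; field_simp; ring
        have h6 : (m : ℚ) < M := by nlinarith
      · have : m < M := by exact_mod_cast h6
        omega
      · have : (p : ℚ) < B := by nlinarith
        exact_mod_cast this
    · rintro ⟨⟨m, p, -, rfl, rfl, rfl⟩, h3⟩
      exact ⟨rfl, h3⟩

theorem derivSymbol_zero (β : LaurentSeries ℂ) (f : PowerSeries ℂ) : derivSymbol β f 0 = 1 := by
  rw [derivSymbol, expSharp_coeff_zero]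
  rw [map_neg, constantCoeff_derivExponent, neg_zero]

/-- The nir-transform as a sum of iterated integrals. -/
theorem hasFormalSum_nir {β : LaurentSeries ℂ} (hβ : IsAdmissible β) (hf : f ≠ 0)
    (hρ : IsDetermination f ρ) {gs : Ramified} (hg : IsReciprocal f ρ gs) :
    HasFormalSum (nirTerm β f ρ) (nir β f ρ) ∧
    HasFormalSum (fun s : ℕ => integ^[s] (deriv gs * PowerSeries.heval gs (derivSymbol β f s)))
      (nir β f ρ) := by
  obtain ⟨a, ha⟩ := exists_hasFormalSum_refinedTerm (f := f) (ρ := ρ) β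
  have h1 := hasFormalSum_nirTerm hβ ha
  have h2 : nir β f ρ = a := h1.formalSum_eq
  rw [h2]
  exact ⟨h1, hasFormalSum_derivSymbol hf hρ hg ha⟩

/-- The lowest exponent `1 / (κ + 1) - 1` receives only the term `s = 0`, which is `g` itself. -/
theorem nir_ne_zero {β : LaurentSeries ℂ} (hβ : IsAdmissible β) (hf : f ≠ 0)
    (hρ : IsDetermination f ρ) : nir β f ρ ≠ 0 := by
  obtain ⟨gs, hg, -⟩ := existsUnique_isReciprocal hf hρ
  intro h0
  have h1 := (hasFormalSum_nir hβ hf hρ hg).2.coeff (1 / ((tangency f : ℚ) + 1) - 1)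
  rw [finsum_eq_single _ 0, h0, derivSymbol_zero, map_one, mul_one, Function.iterate_zero, id_eq,
    coeff_deriv, sub_add_cancel, hg.lead] at h1
  · refine mul_ne_zero ?_ (leadCoeff_ne_zero (κ := tangency f) (determination_ne_zero hf hρ)) h1.symm
    exact_mod_cast (root_pos (tangency f)).ne'
  · intro s hs
    by_contra hc
    have := (hg.onLattice hf hρ (derivSymbol β f s)).iterate_integ_gt s hc
    have h2 : (0 : ℚ) < s := by exact_mod_cast Nat.pos_of_ne_zero hs
    linarith

end

noncomputable section

/-! ### The iterated Lie derivatives as differential polynomials -/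

section Universal

open MvPolynomial

/-- The derivation `u_i ↦ u_{i+1}` of the ring of differential polynomials. -/
def shift : Derivation ℤ (MvPolynomial ℕ ℤ) (MvPolynomial ℕ ℤ) :=
  mkDerivation ℤ fun i => X (i + 1)

/-- Serves both gradings: `e = 0` for the degree, `e = 1` for the order. -/
theorem isWeightedHomogeneous_shift {w : ℕ → ℕ} {e : ℕ} (hw : ∀ i, w (i + 1) = w i + e)
    {p : MvPolynomial ℕ ℤ} {n : ℕ} (hp : IsWeightedHomogeneous w p n) :
    IsWeightedHomogeneous w (shift p) (n + e) := by
  rw [← support_sum_monomial_coeff p, map_sum]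
  refine IsWeightedHomogeneous.sum _ _ _ fun d hd => ?_
  rw [shift, mkDerivation_monomial, Finsupp.sum]
  refine (weightedHomogeneousSubmodule ℤ w _).smul_mem _ ?_
  rw [mem_weightedHomogeneousSubmodule]
  refine IsWeightedHomogeneous.sum _ _ _ fun i hi => ?_
  rw [smul_eq_mul]
  have h1 : Finsupp.single i 1 ≤ d := by
    rw [Finsupp.single_le_iff]
    exact Nat.one_le_iff_ne_zero.2 (Finsupp.mem_support_iff.1 hi)
  have h2 := congrArg (Finsupp.weight w) (tsub_add_cancel_of_le h1)
  rw [map_add, Finsupp.weight_single, one_smul, hp (mem_support_iff.1 hd)] at h2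
  rw [← h2, add_assoc, ← hw]
  exact (isWeightedHomogeneous_monomial w _ _ rfl).mul (isWeightedHomogeneous_X ℤ w (i + 1))

/-- The differential polynomial `(u_0 ∂) ^ r u_0`. -/
def liePoly : ℕ → MvPolynomial ℕ ℤ
  | 0 => X 0
  | r + 1 => X 0 * shift (liePoly r)

theorem X_dvd_liePoly (r : ℕ) : X 0 ∣ liePoly r := by
  cases r with
  | zero => exact dvd_rfl
  | succ r => exact dvd_mul_right _ _

theorem liePoly_degree (r : ℕ) :
    IsWeightedHomogeneous (fun _ : ℕ => 1) (liePoly r) (r + 1) := by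
  induction r with
  | zero => exact isWeightedHomogeneous_X ℤ _ 0
  | succ r ih =>
    rw [add_comm (r + 1)]
    exact (isWeightedHomogeneous_X ℤ _ 0).mul
      (isWeightedHomogeneous_shift (e := 0) (fun _ => rfl) ih)

theorem liePoly_order (r : ℕ) : IsWeightedHomogeneous (fun i : ℕ => i) (liePoly r) r := by
  induction r with
  | zero => exact isWeightedHomogeneous_X ℤ _ 0
  | succ r ih =>
    rw [liePoly, ← zero_add (r + 1)]
    exact (isWeightedHomogeneous_X ℤ (fun i : ℕ => i) 0).mul
      (isWeightedHomogeneous_shift (w := fun i => i) (e := 1) (fun _ => rfl) ih)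

/-- Evaluation of differential polynomials. -/
def jet (a : Ramified) : MvPolynomial ℕ ℤ →+* Ramified :=
  eval₂Hom (Int.castRingHom Ramified) fun i => deriv^[i] a

theorem jet_X (a : Ramified) (i : ℕ) : jet a (X i) = deriv^[i] a := eval₂Hom_X' _ _ _

theorem jet_shift (a : Ramified) (p : MvPolynomial ℕ ℤ) : jet a (shift p) = deriv (jet a p) := by
  induction p using MvPolynomial.induction_on with
  | C k =>
    rw [shift, derivation_C, map_zero, jet, eval₂Hom_C, eq_intCast, ← mul_one (k : Ramified),
      ← zsmul_eq_mul, ← derivₗ_apply, map_zsmul, derivₗ_apply, deriv_one, smul_zero]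
  | add p q hp hq =>
    rw [map_add, map_add, hp, hq, map_add, ← derivₗ_apply (_ + _), map_add]
    rfl
  | mul_X p i hp =>
    rw [Derivation.leibniz, map_add, smul_eq_mul, smul_eq_mul, map_mul, map_mul, hp, map_mul,
      deriv_mul, shift, mkDerivation_X, jet_X, jet_X, Function.iterate_succ_apply']
    ring

theorem jet_liePoly (a : Ramified) (r : ℕ) :
    jet a (liePoly r) = (fun φ => a * deriv φ)^[r] a := by
  induction r with
  | zero => exact jet_X a 0
  | succ r ih => rw [liePoly, map_mul, jet_X, jet_shift, ih, Function.iterate_succ_apply']; rfl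

/-- A tuple `(n_0, …, n_s)` as an exponent. -/
def tupleExponent {s : ℕ} (n : Fin (s + 1) → ℕ) : ℕ →₀ ℕ :=
  Finsupp.onFinset (Finset.range (s + 1)) (fun i => if h : i < s + 1 then n ⟨i, h⟩ else 0) <| by
    intro i hi
    by_contra h
    rw [Finset.mem_range] at h
    exact hi (dif_neg h)

theorem tupleExponent_apply {s : ℕ} (n : Fin (s + 1) → ℕ) (i : Fin (s + 1)) :
    tupleExponent n i = n i := dif_pos i.2

theorem support_tupleExponent {s : ℕ} (n : Fin (s + 1) → ℕ) :
    (tupleExponent n).support ⊆ Finset.range (s + 1) := Finsupp.support_onFinset_subset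

theorem tupleExponent_injective (s : ℕ) :
    Function.Injective (tupleExponent : (Fin (s + 1) → ℕ) → ℕ →₀ ℕ) := by
  intro n n' h
  funext i
  rw [← tupleExponent_apply n, h, tupleExponent_apply]

theorem prod_tupleExponent {A : Type} [CommRing A] (x : ℕ → A) {s : ℕ} (n : Fin (s + 1) → ℕ) :
    ∏ i ∈ (tupleExponent n).support, x i ^ tupleExponent n i
      = ∏ i : Fin (s + 1), x i ^ n i := by
  rw [Finset.prod_subset (support_tupleExponent n), Finset.prod_range]
  · exact Finset.prod_congr rfl fun i _ => by rw [tupleExponent_apply]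
  · intro i _ hi
    rw [Finsupp.notMem_support_iff.1 hi, pow_zero]

theorem mem_multiIndices {r s : ℕ} {n : Fin (s + 1) → ℕ} :
    n ∈ multiIndices r s ↔ ∑ i, n i = r ∧ ∑ i : Fin (s + 1), (i : ℕ) * n i = s := by
  simp [multiIndices]

/-- A monomial of order `s` contains no derivative of order beyond `s`, so tuples of length `s + 1`
suffice. -/
theorem exists_tupleExponent {r s : ℕ} {d : ℕ →₀ ℕ} (h1 : Finsupp.weight (fun _ : ℕ => 1) d = r)
    (h2 : Finsupp.weight (fun i : ℕ => i) d = s) :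
    ∃ n ∈ multiIndices r s, tupleExponent n = d := by
  have hd : d.support ⊆ Finset.range (s + 1) := by
    intro i hi
    rw [Finset.mem_range, Nat.lt_succ_iff, ← h2]
    exact Finsupp.le_weight_of_ne_zero' (fun i : ℕ => i) (Finsupp.mem_support_iff.1 hi)
  rw [Finsupp.weight_apply, Finsupp.sum_of_support_subset _ hd _ (by simp),
    Finset.sum_range] at h1 h2
  refine ⟨fun i => d i, mem_multiIndices.2 ⟨by simpa using h1, by simpa [mul_comm] using h2⟩, ?_⟩
  ext i
  by_cases hi : i < s + 1
  · exact dif_pos hi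
  · refine (dif_neg hi).trans ?_
    by_contra hc
    exact hi (Finset.mem_range.1 (hd (Finsupp.mem_support_iff.2 (Ne.symm hc))))

/-- A doubly homogeneous differential polynomial divisible by `u_0`, in terms of the
multi-indices of its monomials. -/
theorem eval₂_eq_sum_multiIndices {A : Type} [CommRing A] (φ : ℤ →+* A) (x : ℕ → A)
    {P : MvPolynomial ℕ ℤ} {r s : ℕ} (hX : X 0 ∣ P)
    (h1 : IsWeightedHomogeneous (fun _ : ℕ => 1) P (r + 1))
    (h2 : IsWeightedHomogeneous (fun i : ℕ => i) P s) :
    eval₂Hom φ x P = x 0 * ∑ n ∈ multiIndices r s,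
      φ (P.coeff (tupleExponent n + Finsupp.single 0 1)) * ∏ i : Fin (s + 1), x i ^ n i := by
  classical
  obtain ⟨Q, rfl⟩ := hX
  have hc : ∀ d, (X 0 * Q).coeff (d + Finsupp.single 0 1) = Q.coeff d := fun d => by
    rw [add_comm, coeff_X_mul]
  rw [map_mul, eval₂Hom_X', coe_eval₂Hom, eval₂_eq]
  simp only [hc]
  congr 1
  simp only [← prod_tupleExponent x]
  rw [← Finset.sum_image (g := tupleExponent) (s := multiIndices r s)
    (f := fun d => φ (Q.coeff d) * ∏ i ∈ d.support, x i ^ d i)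
    (tupleExponent_injective s).injOn]
  refine Finset.sum_subset ?_ ?_
  · intro d hd
    rw [mem_support_iff, ← hc] at hd
    have e1 := h1 hd
    have e2 := h2 hd
    rw [map_add, Finsupp.weight_single] at e1 e2
    obtain ⟨n, hn, rfl⟩ := exists_tupleExponent (r := r) (s := s)
      (d := d) (by simpa using e1) (by simpa using e2)
    exact Finset.mem_image_of_mem _ hn
  · intro d _ hd
    rw [notMem_support_iff.1 hd, map_zero, zero_mul]

end Universal

/-! ### The coefficients of the expansion of mir -/

section Coefficients

open MvPolynomial

/-- The variable `β_k`, which is `0` for `k = 0`. -/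
def betaVar (k : ℕ) : MvPolynomial ℕ+ ℤ := if h : 0 < k then X ⟨k, h⟩ else 0

theorem betaVar_isWeightedHomogeneous (w : ℕ → ℕ) (k : ℕ) :
    IsWeightedHomogeneous (fun i : ℕ+ => w i) (betaVar k) (w k) := by
  rw [betaVar]
  split_ifs with h
  · exact isWeightedHomogeneous_X ℤ (fun i : ℕ+ => w i) ⟨k, h⟩
  · exact isWeightedHomogeneous_zero _ _ _

/-- The coefficient of `u ^ d` in the coefficient of `I ^ s` of `(∑_r β_r I ^ r (u_0 ∂) ^ r u_0) ^ m`. -/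
def powerCoeff (m s : ℕ) (d : ℕ →₀ ℕ) : MvPolynomial ℕ+ ℤ :=
  ∑ l ∈ Finset.finsuppAntidiag (Finset.range m) s,
    C ((∏ i ∈ Finset.range m, liePoly (l i)).coeff d) * ∏ i ∈ Finset.range m, betaVar (l i)

theorem powerCoeff_isWeightedHomogeneous (w : ℕ → ℕ) {m s t : ℕ} (d : ℕ →₀ ℕ)
    (h : ∀ l ∈ Finset.finsuppAntidiag (Finset.range m) s, ∑ i ∈ Finset.range m, w (l i) = t) :
    IsWeightedHomogeneous (fun i : ℕ+ => w i) (powerCoeff m s d) t := by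
  refine IsWeightedHomogeneous.sum _ _ _ fun l hl => ?_
  rw [← h l hl, ← zero_add (∑ i ∈ Finset.range m, w (l i))]
  exact (isWeightedHomogeneous_C _ _).mul
    (IsWeightedHomogeneous.prod _ _ _ fun i _ => betaVar_isWeightedHomogeneous w (l i))

theorem powerCoeff_degree (m s : ℕ) (d : ℕ →₀ ℕ) :
    IsWeightedHomogeneous (fun i : ℕ+ => (i : ℕ) + 1) (powerCoeff m s d) (s + m) := by
  refine powerCoeff_isWeightedHomogeneous (fun k => k + 1) d fun l hl => ?_
  rw [Finset.mem_finsuppAntidiag] at hl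
  rw [Finset.sum_add_distrib, hl.1]
  simp

theorem powerCoeff_order (m s : ℕ) (d : ℕ →₀ ℕ) :
    IsWeightedHomogeneous (fun i : ℕ+ => (i : ℕ)) (powerCoeff m s d) s :=
  powerCoeff_isWeightedHomogeneous (fun k => k) d fun _ hl => (Finset.mem_finsuppAntidiag.1 hl).1

/-- The universal coefficients `Mir^{n_0, …, n_s}`. -/
def mirCoefficients : Coefficients := fun s n =>
  let m := ∑ i, n i + 1 - s
  if s ≤ ∑ i, n i ∧ ∑ i, n i + 1 ≤ 2 * s then
    C ((-1) ^ m / (m.factorial : ℚ)) * map (Int.castRingHom ℚ)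
      (powerCoeff m s (tupleExponent n + Finsupp.single 0 1))
  else 0

theorem mirCoefficients_eq {r s : ℕ} {n : Fin (s + 1) → ℕ} (hn : n ∈ multiIndices r s)
    (h : s ≤ r ∧ r + 1 ≤ 2 * s) :
    mirCoefficients s n = C ((-1) ^ (r + 1 - s) / ((r + 1 - s).factorial : ℚ)) *
      map (Int.castRingHom ℚ)
        (powerCoeff (r + 1 - s) s (tupleExponent n + Finsupp.single 0 1)) := by
  rw [mem_multiIndices] at hn
  obtain ⟨rfl, -⟩ := hn
  exact if_pos h

theorem mirCoefficients_eq_zero {r s : ℕ} {n : Fin (s + 1) → ℕ} (hn : n ∈ multiIndices r s)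
    (h : ¬ (s ≤ r ∧ r + 1 ≤ 2 * s)) : mirCoefficients s n = 0 := by
  rw [mem_multiIndices] at hn
  obtain ⟨rfl, -⟩ := hn
  exact if_neg h

/-- The denominator is `m!` with `m = r + 1 - s ≤ s`, and `m!` divides `s!`. -/
theorem exists_mirCoefficients_eq {r s : ℕ} {n : Fin (s + 1) → ℕ} (hn : n ∈ multiIndices r s) :
    ∃ P : MvPolynomial ℕ+ ℤ, mirCoefficients s n =
      C (1 / (s.factorial : ℚ)) * map (Int.castRingHom ℚ) P := by
  by_cases h : s ≤ r ∧ r + 1 ≤ 2 * s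
  · obtain ⟨k, hk⟩ := Nat.factorial_dvd_factorial (show r + 1 - s ≤ s by omega)
    refine ⟨C ((-1) ^ (r + 1 - s) * (k : ℤ)) *
      powerCoeff (r + 1 - s) s (tupleExponent n + Finsupp.single 0 1), ?_⟩
    rw [mirCoefficients_eq hn h, map_mul, map_C, ← mul_assoc, ← map_mul C]
    congr 2
    have h1 : ((r + 1 - s).factorial : ℚ) ≠ 0 := by positivity
    have h2 : (s.factorial : ℚ) ≠ 0 := by positivity
    have h3 : (s.factorial : ℚ) = (r + 1 - s).factorial * k := by exact_mod_cast hk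
    rw [eq_intCast]
    push_cast
    field_simp
    rw [h3]
  · exact ⟨0, by rw [mirCoefficients_eq_zero hn h, map_zero, mul_zero]⟩

theorem mirCoefficients_isWeightedHomogeneous {w : ℕ+ → ℕ} {t r s : ℕ} {n : Fin (s + 1) → ℕ}
    (hn : n ∈ multiIndices r s) (h : s ≤ r → IsWeightedHomogeneous w
      (powerCoeff (r + 1 - s) s (tupleExponent n + Finsupp.single 0 1)) t) :
    IsWeightedHomogeneous w (mirCoefficients s n) t := by
  by_cases hrs : s ≤ r ∧ r + 1 ≤ 2 * s
  · rw [mirCoefficients_eq hn hrs]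
    intro d hd
    rw [coeff_C_mul, coeff_map] at hd
    refine h hrs.1 fun h0 => hd ?_
    rw [h0, map_zero, mul_zero]
  · rw [mirCoefficients_eq_zero hn hrs]
    exact isWeightedHomogeneous_zero _ _ _

theorem mirCoefficients_degree {r s : ℕ} {n : Fin (s + 1) → ℕ} (hn : n ∈ multiIndices r s) :
    IsWeightedHomogeneous (fun i : ℕ+ => (i : ℕ) + 1) (mirCoefficients s n) (r + 1) := by
  refine mirCoefficients_isWeightedHomogeneous hn fun h => ?_
  have h1 := powerCoeff_degree (r + 1 - s) s (tupleExponent n + Finsupp.single 0 1)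
  rwa [show s + (r + 1 - s) = r + 1 by omega] at h1

theorem mirCoefficients_order {r s : ℕ} {n : Fin (s + 1) → ℕ} (hn : n ∈ multiIndices r s) :
    IsWeightedHomogeneous (fun i : ℕ+ => (i : ℕ)) (mirCoefficients s n) s :=
  mirCoefficients_isWeightedHomogeneous hn fun _ => powerCoeff_order _ _ _

/-- A polynomial of odd degree in the variables `β_i` of degree `i + 1` vanishes when all `β_{2m}`
do. -/
theorem aeval_eq_zero_of_odd_degree {P : MvPolynomial ℕ+ ℚ} {t : ℕ}
    (h : IsWeightedHomogeneous (fun i : ℕ+ => (i : ℕ) + 1) P t) (ht : Odd t) {b : ℕ+ → ℂ}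
    (hb : ∀ i : ℕ+, Even (i : ℕ) → b i = 0) : aeval b P = 0 := by
  rw [aeval_def, eval₂_eq]
  refine Finset.sum_eq_zero fun d hd => ?_
  by_contra hc
  have hw := h (mem_support_iff.1 hd)
  rw [Finsupp.weight_apply, Finsupp.sum] at hw
  refine Nat.not_even_iff_odd.2 ht (hw ▸ Finset.even_sum _ fun i hi => ?_)
  have h1 : b i ^ d i ≠ 0 := Finset.prod_ne_zero_iff.1 (right_ne_zero_of_mul hc) i hi
  have h2 : b i ≠ 0 := fun h0 => h1 (by rw [h0, zero_pow (Finsupp.mem_support_iff.1 hi)])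
  have h3 : Odd (i : ℕ) := Nat.not_even_iff_odd.1 fun he => h2 (hb i he)
  exact (h3.add_odd odd_one).mul_left _

theorem aeval_powerCoeff (β : LaurentSeries ℂ) (m s : ℕ) (d : ℕ →₀ ℕ) :
    aeval (fun i : ℕ+ => β.coeff ((i : ℕ) : ℤ)) (map (Int.castRingHom ℚ) (powerCoeff m s d))
      = ∑ l ∈ Finset.finsuppAntidiag (Finset.range m) s,
        (((∏ i ∈ Finset.range m, liePoly (l i)).coeff d : ℤ) : ℂ) *
          ∏ i ∈ Finset.range m, (if l i = 0 then 0 else β.coeff (l i : ℤ)) := by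
  have hb : ∀ k, aeval (fun i : ℕ+ => β.coeff ((i : ℕ) : ℤ))
      (map (Int.castRingHom ℚ) (betaVar k)) = if k = 0 then 0 else β.coeff (k : ℤ) := by
    intro k
    rw [betaVar]
    split_ifs with h1 h2 h2
    · omega
    · exact (congrArg _ (map_X _ _)).trans (aeval_X _ _)
    · rw [map_zero, map_zero]
    · omega
  rw [powerCoeff, map_sum, map_sum]
  refine Finset.sum_congr rfl fun l _ => ?_
  rw [map_mul, map_mul, map_prod, map_prod, map_C, aeval_C]
  simp only [hb]
  simp

theorem Ramified.sum_smul {ι : Type} (t : Finset ι) (c : ι → ℂ) (a : Ramified) :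
    (∑ i ∈ t, c i) • a = ∑ i ∈ t, c i • a := by
  simp only [Ramified.smul_eq_C_mul, map_sum, Finset.sum_mul]

/-- A product of `m` polynomials `liePoly (l i)` with `∑ l i = s` has degree `s + m` and order `s`.
The factor `a` in front, available because `m ≠ 0`, is the one that `1 / gbar` cancels; it lowers
the degree to `r = s + m - 1`. -/
theorem coeff_mirExponent_pow (β : LaurentSeries ℂ) (a : Ramified) {m s r : ℕ}
    (hr : s + m = r + 1) (hm : m ≠ 0) :
    (mirExponent β a ^ m).coeff s = a * ∑ n ∈ multiIndices r s,
      aeval (fun i : ℕ+ => β.coeff ((i : ℕ) : ℤ)) (map (Int.castRingHom ℚ)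
        (powerCoeff m s (tupleExponent n + Finsupp.single 0 1))) •
          ∏ i : Fin (s + 1), (deriv^[(i : ℕ)] a) ^ n i := by
  have he : ∀ k, (mirExponent β a).coeff k
      = (if k = 0 then 0 else β.coeff (k : ℤ)) • jet a (liePoly k) := by
    intro k
    rw [mirExponent, PowerSeries.coeff_mk, jet_liePoly]
    split_ifs with h
    · rw [Ramified.zero_smul]
    · rfl
  have hl : ∀ l ∈ Finset.finsuppAntidiag (Finset.range m) s,
      jet a (∏ i ∈ Finset.range m, liePoly (l i)) = a * ∑ n ∈ multiIndices r s,
        (((∏ i ∈ Finset.range m, liePoly (l i)).coeff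
          (tupleExponent n + Finsupp.single 0 1) : ℤ) : ℂ) •
          ∏ i : Fin (s + 1), (deriv^[(i : ℕ)] a) ^ n i := by
    intro l hl
    rw [Finset.mem_finsuppAntidiag] at hl
    rw [jet, eval₂_eq_sum_multiIndices (r := r) (s := s)]
    · congr 1
      refine Finset.sum_congr rfl fun n _ => ?_
      rw [eq_intCast, Ramified.smul_eq_C_mul, map_intCast]
    · exact (X_dvd_liePoly _).trans
        (Finset.dvd_prod_of_mem _ (Finset.mem_range.2 (Nat.pos_of_ne_zero hm)))
    · rw [← hr]
      convert IsWeightedHomogeneous.prod _ _ _ fun i (_ : i ∈ Finset.range m) =>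
        liePoly_degree (l i)
      rw [Finset.sum_add_distrib, hl.1]
      simp
    · convert IsWeightedHomogeneous.prod _ _ _ fun i (_ : i ∈ Finset.range m) =>
        liePoly_order (l i)
      exact hl.1.symm
  rw [PowerSeries.coeff_pow]
  simp only [he, aeval_powerCoeff, Finset.prod_smul, Ramified.sum_smul]
  rw [Finset.sum_comm, Finset.mul_sum]
  refine Finset.sum_congr rfl fun l hl' => ?_
  rw [← map_prod, hl l hl', ← mul_smul_comm, Finset.smul_sum]
  congr 1
  refine Finset.sum_congr rfl fun n _ => ?_
  rw [smul_smul, mul_comm]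

theorem mul_diffOp (β : LaurentSeries ℂ) (a : Ramified) {r s : ℕ} (h : s ≤ r ∧ r + 1 ≤ 2 * s) :
    a * diffOp mirCoefficients β r s a
      = ((-1) ^ (r + 1 - s) / ((r + 1 - s).factorial : ℂ)) •
        (mirExponent β a ^ (r + 1 - s)).coeff s := by
  rw [coeff_mirExponent_pow β a (m := r + 1 - s) (r := r) (by omega) (by omega), ← mul_smul_comm,
    diffOp, Finset.smul_sum]
  congr 1
  refine Finset.sum_congr rfl fun n hn => ?_
  rw [mirCoefficients_eq hn h, map_mul, aeval_C, smul_smul]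
  congr 2
  simp

end Coefficients

end

/-! ### The formula for mir and its expansion -/

noncomputable section

variable {f : PowerSeries ℂ} {ρ : ℂ}

/-- Evaluation at `x = g*` carries `∂_x` to `gbar ∂_ν`, so the exponent of the mir formula is the
exponent found inside the nir integral. -/
theorem mirExponent_inv_deriv (β : LaurentSeries ℂ) {gs : Ramified} (hg : IsReciprocal f ρ gs) :
    mirExponent β (deriv gs)⁻¹
      = PowerSeries.map (PowerSeries.heval gs : PowerSeries ℂ →+* Ramified)
        (derivExponent β f) := by
  ext1 r
  rw [mirExponent, PowerSeries.coeff_mk, PowerSeries.coeff_map, derivExponent,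
    PowerSeries.coeff_mk, hg.iterate]
  split_ifs
  · rw [map_zero]
  · exact (map_smul (hevalₗ gs) _ _).symm

theorem coeff_mirSymbol (β : LaurentSeries ℂ) {gs : Ramified} (hg : IsReciprocal f ρ gs) (s : ℕ) :
    (mirSymbol β (deriv gs)⁻¹).coeff s
      = deriv gs * PowerSeries.heval gs (derivSymbol β f s) := by
  have h0 : PowerSeries.constantCoeff (-derivExponent β f) = 0 := by
    rw [map_neg, constantCoeff_derivExponent, neg_zero]
  rw [mirSymbol, inv_inv, mirExponent_inv_deriv β hg, ← map_neg, expSharp_map _ h0,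
    PowerSeries.coeff_C_mul, PowerSeries.coeff_map]
  rfl

/-- The part of degree `m` in the exponent of the coefficient of `I ^ s` of the formula for mir. -/
def expTerm (β : LaurentSeries ℂ) (f : PowerSeries ℂ) (m s : ℕ) : PowerSeries ℂ :=
  ((-1) ^ m / (m.factorial : ℂ)) • (derivExponent β f ^ m).coeff s

theorem derivSymbol_eq_sum (β : LaurentSeries ℂ) (f : PowerSeries ℂ) {s M : ℕ} (h : s < M) :
    derivSymbol β f s = ∑ m ∈ Finset.range M, expTerm β f m s := by
  rw [derivSymbol, coeff_expSharp (by rw [map_neg, constantCoeff_derivExponent, neg_zero]) h]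
  refine Finset.sum_congr rfl fun m _ => ?_
  rw [expTerm]
  have h1 : ∀ a : PowerSeries ℂ, (1 / (m.factorial : ℚ)) • a = (1 / (m.factorial : ℂ)) • a := by
    intro a
    ext n
    rw [map_rat_smul, PowerSeries.coeff_smul, Rat.smul_def, smul_eq_mul]
    push_cast
    rfl
  rw [h1, neg_pow]
  rcases neg_one_pow_eq_or ℂ m with h2 | h2
  · rw [h2, Even.neg_one_pow, one_mul]
    by_contra ho
    rw [(Nat.not_even_iff_odd.1 ho).neg_one_pow] at h2
    norm_num at h2
  · rw [h2, Odd.neg_one_pow, neg_one_mul, map_neg, smul_neg, neg_div, neg_smul]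
    by_contra ho
    rw [(Nat.not_odd_iff_even.1 ho).neg_one_pow] at h2
    norm_num at h2

theorem expTerm_eq_zero_of_lt (β : LaurentSeries ℂ) (f : PowerSeries ℂ) {m s : ℕ} (h : s < m) :
    expTerm β f m s = 0 := by
  rw [expTerm, coeff_pow_eq_zero (constantCoeff_derivExponent β f) h, smul_zero]

theorem expTerm_zero (β : LaurentSeries ℂ) (f : PowerSeries ℂ) {s : ℕ} (h : s ≠ 0) :
    expTerm β f 0 s = 0 := by
  rw [expTerm, pow_zero (derivExponent β f), PowerSeries.coeff_one, if_neg h, smul_zero]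

theorem expTerm_zero_zero (β : LaurentSeries ℂ) (f : PowerSeries ℂ) : expTerm β f 0 0 = 1 := by
  simp [expTerm]

theorem diffOp_inv_deriv (β : LaurentSeries ℂ) {gs : Ramified} (hg : IsReciprocal f ρ gs)
    {r s : ℕ} (h : s ≤ r ∧ r + 1 ≤ 2 * s) :
    diffOp mirCoefficients β r s (deriv gs)⁻¹
      = deriv gs * PowerSeries.heval gs (expTerm β f (r + 1 - s) s) := by
  rw [← inv_mul_cancel_left₀ (inv_ne_zero hg.deriv_ne_zero) (diffOp _ _ _ _ _), inv_inv,
    mul_diffOp β _ h, mirExponent_inv_deriv β hg, ← map_pow, PowerSeries.coeff_map]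
  congr 1
  exact (map_smul (hevalₗ gs) _ _).symm

/-- The formula for mir, expanded by order and degree of its exponent. -/
theorem hasFormalSum_expTerm {β : LaurentSeries ℂ} (hβ : IsAdmissible β) (hf : f ≠ 0)
    (hρ : IsDetermination f ρ) {gs : Ramified} (hg : IsReciprocal f ρ gs) :
    HasFormalSum (fun i : ℕ × ℕ =>
      integ^[i.1] (deriv gs * PowerSeries.heval gs (expTerm β f i.2 i.1))) (nir β f ρ) := by
  have hL : ∀ i : ℕ × ℕ, OnLattice (tangency f)
      (integ^[i.1] (deriv gs * PowerSeries.heval gs (expTerm β f i.2 i.1))) :=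
    fun i => (hg.onLattice hf hρ _).iterate_integ i.1
  have hs : ∀ (s m : ℕ) (q : ℚ), (integ^[s]
      (deriv gs * PowerSeries.heval gs (expTerm β f m s))).coeff q ≠ 0 → m ≤ s ∧ (s : ℚ) < q + 1 := by
    intro s m q hq
    constructor
    · by_contra! h
      refine hq ?_
      rw [expTerm_eq_zero_of_lt β f h, map_zero, mul_zero, iterate_integ_eq, map_zero]
      rfl
    · have h1 := (hg.onLattice hf hρ (expTerm β f m s)).iterate_integ_gt s hq
      have := root_pos (tangency f)
      linarith
  obtain ⟨a, ha⟩ := exists_hasFormalSum_of_onLattice (tangency f) hL fun q => by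
    obtain ⟨N, hN⟩ := exists_nat_gt (q + 1)
    refine ((Finset.range N ×ˢ Finset.range N).finite_toSet).subset ?_
    rintro ⟨s, m⟩ h
    obtain ⟨h1, h2⟩ := hs s m q h
    have h3 : s < N := by exact_mod_cast h2.trans hN
    simp only [Finset.coe_product, Set.mem_prod, Finset.mem_coe, Finset.mem_range]
    omega
  have h1 : HasFormalSum
      (fun s : ℕ => integ^[s] (deriv gs * PowerSeries.heval gs (derivSymbol β f s))) a := by
    refine ha.fiberwise Prod.fst fun s q => ?_
    have hinj : Set.InjOn (fun m : ℕ => (s, m)) ↑(Finset.range (s + 1)) :=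
      fun m _ m' _ h => (Prod.mk.inj h).2
    rw [finsum_mem_eq_sum_of_inter_support_eq
      (t := (Finset.range (s + 1)).image fun m => (s, m)), Finset.sum_image hinj,
      derivSymbol_eq_sum β f (Nat.lt_succ_self s), map_sum, Finset.mul_sum, iterate_integ_eq,
      map_sum, HahnSeries.coeff_sum]
    · exact Finset.sum_congr rfl fun m _ => by rw [iterate_integ_eq]
    · ext ⟨s', m⟩
      simp only [Set.mem_inter_iff, Set.mem_ofPred_eq, Function.mem_support, Finset.coe_image,
        Finset.coe_range, Set.mem_image, Set.mem_Iio, Prod.mk.injEq]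
      constructor
      · rintro ⟨rfl, h⟩
        exact ⟨⟨m, Nat.lt_succ_of_le (hs s' m q h).1, rfl, rfl⟩, h⟩
      · rintro ⟨⟨m, -, rfl, rfl⟩, h⟩
        exact ⟨rfl, h⟩
  rwa [(hasFormalSum_nir hβ hf hρ hg).2.unique h1]

/-- Reindex by `m = r + 1 - s`. The pair `s = m = 0` gives `1 / gbar = g`, which is split off; all
other pairs outside `1 ≤ m ≤ s` vanish. -/
theorem hasFormalSum_diffOp {β : LaurentSeries ℂ} (hβ : IsAdmissible β) (hf : f ≠ 0)
    (hρ : IsDetermination f ρ) {gs : Ramified} (hg : IsReciprocal f ρ gs) :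
    HasFormalSum (fun p : DegreeOrder =>
      integ^[p.1.2] (diffOp mirCoefficients β p.1.1 p.1.2 (deriv gs)⁻¹))
      (nir β f ρ - deriv gs) := by
  have h := (hasFormalSum_expTerm hβ hf hρ hg).comp_injective
    (e := fun p : DegreeOrder => (p.1.2, p.1.1 + 1 - p.1.2)) ?_ (0, 0) ?_ ?_
  · rw [expTerm_zero_zero, map_one, mul_one] at h
    change HasFormalSum _ (nir β f ρ - deriv gs) at h
    convert h using 1
    funext p
    rw [diffOp_inv_deriv β hg ⟨p.2.2.2, p.2.2.1⟩]
    rfl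
  · rintro ⟨⟨r, s⟩, h1, h2, h3⟩ ⟨⟨r', s'⟩, h1', h2', h3'⟩ h
    simp only [Prod.mk.injEq, Subtype.mk.injEq] at h h1 h2 h3 h1' h2' h3' ⊢
    omega
  · rintro ⟨⟨⟨r, s⟩, h1, h2, h3⟩, h⟩
    simp only [Prod.mk.injEq] at h h1 h2 h3
    omega
  · rintro ⟨s, m⟩ hi h0
    have hz : expTerm β f m s = 0 := by
      by_cases hsm : s < m
      · exact expTerm_eq_zero_of_lt β f hsm
      · by_cases hm : m = 0
        · subst hm
          exact expTerm_zero β f fun hs => h0 (by rw [hs])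
        · refine absurd ⟨⟨(s + m - 1, s), ?_, ?_, ?_⟩, ?_⟩ hi
          · simp only; omega
          · simp only; omega
          · simp only; omega
          · simp only [Prod.mk.injEq, true_and]; omega
    simp only [hz, map_zero, mul_zero]
    rw [iterate_integ_eq, map_zero]

theorem diffOp_eq_zero_of_even {β : LaurentSeries ℂ}
    (hβ : ∀ m : ℕ, 1 ≤ m → β.coeff ((2 * m : ℕ) : ℤ) = 0) {r : ℕ} (hr : Even r) (s : ℕ)
    (a : Ramified) : diffOp mirCoefficients β r s a = 0 := by
  refine Finset.sum_eq_zero fun n hn => ?_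
  rw [aeval_eq_zero_of_odd_degree (mirCoefficients_degree hn) hr.add_one, Ramified.zero_smul]
  intro i hi
  obtain ⟨k, hk⟩ := even_iff_exists_two_mul.1 hi
  rw [hk]
  exact hβ k (by have := i.pos; omega)

theorem tangency_X_pow (r : ℕ) : tangency (PowerSeries.X ^ r) = r := by
  rw [tangency, PowerSeries.order_X_pow, ENat.toNat_natCast]

theorem expTerm_one_X_pow (β : LaurentSeries ℂ) {r : ℕ} (hr : r ≠ 0) :
    expTerm β (PowerSeries.X ^ r) 1 r = (-(β.coeff (r : ℤ) * r.factorial)) • 1 := by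
  have h1 : (PowerSeries.derivative ℂ)^[r] (PowerSeries.X ^ r) = (r.factorial : ℂ) • 1 := by
    ext n
    rw [coeff_iterate_derivative_eq]
    rw [PowerSeries.coeff_smul, PowerSeries.coeff_X_pow, PowerSeries.coeff_one]
    by_cases hn : n = 0
    · subst hn; simp
    · rw [if_neg (by omega), if_neg hn, zero_mul, smul_zero]
  rw [expTerm, pow_one (derivExponent _ _), derivExponent, PowerSeries.coeff_mk, if_neg hr, h1, smul_smul, smul_smul]
  congr 1
  simp

/-- Take `f = x^r`: its `r`-th derivative is the constant `r!`, so the component is `-β_r r! g`, and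
integration is injective on the lattice. -/
theorem exists_diffOp_ne_zero {β : LaurentSeries ℂ} {r : ℕ} (hr : 1 ≤ r)
    (h : β.coeff (r : ℤ) ≠ 0) :
    ∃ a b : Ramified, IsMir β a b ∧ integ^[r] (diffOp mirCoefficients β r r a) ≠ 0 := by
  have hf : (PowerSeries.X ^ r : PowerSeries ℂ) ≠ 0 := pow_ne_zero _ PowerSeries.X_ne_zero
  have hρ : IsDetermination (PowerSeries.X ^ r) 1 := by
    rw [IsDetermination, tangency_X_pow, PowerSeries.coeff_X_pow_self, one_pow]
  obtain ⟨gs, hg, -⟩ := existsUnique_isReciprocal hf hρ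
  refine ⟨_, _, ⟨_, _, gs, hf, hρ, hg, rfl, rfl⟩, fun h0 => ?_⟩
  rw [diffOp_inv_deriv β hg ⟨le_rfl, by omega⟩] at h0
  have h1 := (hg.onLattice hf hρ _).iterate_integ_eq_zero r h0
  rw [Nat.add_sub_cancel_left, expTerm_one_X_pow β (by omega)] at h1
  have h2 := (mul_eq_zero.1 h1).resolve_left hg.deriv_ne_zero
  rw [← hevalₗ_apply, map_smul, hevalₗ_apply, map_one, Ramified.smul_eq_C_mul, mul_one] at h2
  have h3 := HahnSeries.C_injective (h2.trans (map_zero HahnSeries.C).symm)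
  exact mul_ne_zero h (by exact_mod_cast r.factorial_ne_zero) (neg_eq_zero.1 h3)

end

end MirTransform

theorem mainTheorem3 :
    -- the transforms involved are well defined
    (∀ β : LaurentSeries ℂ, MirTransform.IsAdmissible β →
      ∀ (f : PowerSeries ℂ) (ρ : ℂ), f ≠ 0 → MirTransform.IsDetermination f ρ →
        (∃! gs : MirTransform.Ramified, MirTransform.IsReciprocal f ρ gs) ∧
        MirTransform.HasFormalSum (MirTransform.nirTerm β f ρ) (MirTransform.nir β f ρ) ∧
        MirTransform.nir β f ρ ≠ 0) ∧
    -- the formula for mir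
    (∀ β : LaurentSeries ℂ, MirTransform.IsAdmissible β →
      ∀ gbar hbar : MirTransform.Ramified, MirTransform.IsMir β gbar hbar →
        (∀ s : ℕ, MirTransform.IntegrableAtZero ((MirTransform.mirSymbol β gbar).coeff s)) ∧
        MirTransform.HasFormalSum
          (fun s : ℕ => MirTransform.integ^[s] ((MirTransform.mirSymbol β gbar).coeff s))
          hbar⁻¹) ∧
    -- the expansion of mir into integro-differential components
    (∃ Mir : MirTransform.Coefficients,
      (∀ r s : ℕ, 1 ≤ r → ∀ n ∈ MirTransform.multiIndices r s,
        (∃ P : MvPolynomial ℕ+ ℤ,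
          Mir s n = MvPolynomial.C (1 / (s.factorial : ℚ)) *
            MvPolynomial.map (Int.castRingHom ℚ) P) ∧
        MvPolynomial.IsWeightedHomogeneous (fun i : ℕ+ => (i : ℕ) + 1) (Mir s n) (r + 1) ∧
        MvPolynomial.IsWeightedHomogeneous (fun i : ℕ+ => (i : ℕ)) (Mir s n) s) ∧
      (∀ β : LaurentSeries ℂ, MirTransform.IsAdmissible β →
        ∀ gbar hbar : MirTransform.Ramified, MirTransform.IsMir β gbar hbar →
          (∀ p : MirTransform.DegreeOrder,
            MirTransform.IntegrableAtZero (MirTransform.diffOp Mir β p.1.1 p.1.2 gbar)) ∧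
          ∃ H : MirTransform.Ramified,
            MirTransform.HasFormalSum
              (fun p : MirTransform.DegreeOrder =>
                MirTransform.integ^[p.1.2] (MirTransform.diffOp Mir β p.1.1 p.1.2 gbar)) H ∧
            hbar⁻¹ = gbar⁻¹ + H) ∧
      -- only odd degrees occur when all even-indexed coefficients of `β` vanish
      (∀ β : LaurentSeries ℂ, MirTransform.IsAdmissible β →
        (∀ m : ℕ, 1 ≤ m → β.coeff ((2 * m : ℕ) : ℤ) = 0) →
        ∀ p : MirTransform.DegreeOrder, Even p.1.1 →
          ∀ gbar : MirTransform.Ramified, MirTransform.diffOp Mir β p.1.1 p.1.2 gbar = 0) ∧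
      -- otherwise components of any degree, odd or even, may occur
      (∀ β : LaurentSeries ℂ, MirTransform.IsAdmissible β →
        ∀ r : ℕ, 1 ≤ r → β.coeff (r : ℤ) ≠ 0 →
          ∃ gbar hbar : MirTransform.Ramified, MirTransform.IsMir β gbar hbar ∧
            MirTransform.integ^[r] (MirTransform.diffOp Mir β r r gbar) ≠ 0)) := by
  open MirTransform in
  refine ⟨fun β hβ f ρ hf hρ => ?_, fun β hβ gbar hbar h => ?_,
    mirCoefficients, fun r s _ n hn => ⟨exists_mirCoefficients_eq hn, mirCoefficients_degree hn,
      mirCoefficients_order hn⟩, fun β hβ gbar hbar h => ?_,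
    fun β _ hβ p hp a => diffOp_eq_zero_of_even hβ hp _ a,
    fun β _ r hr h => exists_diffOp_ne_zero hr h⟩
  · obtain ⟨gs, hg, h⟩ := existsUnique_isReciprocal hf hρ
    exact ⟨⟨gs, hg, h⟩, (hasFormalSum_nir hβ hf hρ hg).1, nir_ne_zero hβ hf hρ⟩
  · obtain ⟨f, ρ, gs, hf, hρ, hg, rfl, rfl⟩ := h
    simp only [coeff_mirSymbol β hg, inv_inv]
    exact ⟨fun s => (hg.onLattice hf hρ _).integrableAtZero, (hasFormalSum_nir hβ hf hρ hg).2⟩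
  · obtain ⟨f, ρ, gs, hf, hρ, hg, rfl, rfl⟩ := h
    refine ⟨fun p => ?_, _, hasFormalSum_diffOp hβ hf hρ hg, ?_⟩
    · rw [diffOp_inv_deriv β hg ⟨p.2.2.2, p.2.2.1⟩]
      exact (hg.onLattice hf hρ _).integrableAtZero
    · rw [inv_inv, inv_inv, add_sub_cancel]
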